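/- For $d<\infty$ let $\mathbb{B}_d$ be the open Euclidean unit ball of $\mathbb{C}^d$ and let $H^2_d$ be the Drury–Arveson space of functions $h(z)=\sum_{\alpha\in\mathbb{N}_0^d}c_\alpha z^\alpha$ on $\mathbb{B}_d$ with $\|h\|^2=\sum_\alpha|c_\alpha|^2\frac{\alpha!}{|\alpha|!}<\infty$, which has reproducing kernel $k(z,w)=k_w(z)=\frac{1}{1-\langle z,w\rangle}$. Let $\mathcal{M}_d=\mathrm{Mult}(H^2_d)$ be its multiplier algebra. A set $V\subset\mathbb{B}_d$ is a variety if it is the joint zero set of a family of functions in $\mathcal{M}_d$. For a variety $V$ let $\mathcal{H}_V=\overline{\mathrm{span}}\{k_\lambda:\lambda\in V\}\subset H^2_d$, regarded as a reproducing kernel Hilbert space of functions on $V$, and let $\mathcal{M}_V=\{\varphi|_V:\varphi\in\mathcal{M}_d\}$, normed by the multiplier norm $\|\varphi\|_{\mathcal{M}_V}$, that is, the operator norm of multiplication by $\varphi$ on $\mathcal{H}_V$. An analytic disc attached to the unit sphere is a variety $V\subset\mathbb{B}_d$, $d<\infty$, for which there is an injective analytic map $f:\mathbb{D}\to\mathbb{B}_d$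 on the open unit disc $\mathbb{D}$, with $f'(z)\neq 0$ for all $z\in\mathbb{D}$, such that $V=f(\mathbb{D})$, $f$ extends to a $C^2$ map up to $\overline{\mathbb{D}}$, and $\|f(x)\|=1\iff|x|=1$ for $x\in\overline{\mathbb{D}}$. Such an $f$ is called an embedding map of $V$, and we put $$\mathcal{M}_f=\{\varphi:\mathbb{D}\to\mathbb{C}:\ \varphi\circ f^{-1}\in\mathcal{M}_V\},\qquad \|\varphi\|_{\mathcal{M}_f}=\|\varphi\circ f^{-1}\|_{\mathcal{M}_V}.$$ **Theorem.** Let $V\subset\mathbb{B}_d$ and $W\subset\mathbb{B}_e$ be analytic discs attached to the unit sphere, with embedding maps $f$ and $g$ respectively. If $\mathcal{M}_f$ and $\mathcal{M}_g$ are isomorphic as complex algebras, then there is an automorphism $\mu$ of the unit disc $\mathbb{D}$ (a biholomorphic map of $\mathbb{D}$ onto itself) such that $\mathcal{M}_f=\mathcal{M}_{g\circ\mu}$ with equivalent norms: the two algebras consist of the same functions, and there are constants $c,C>0$ with $c\|\varphi\|_{\mathcal{M}_f}\le\|\varphi\|_{\mathcal{M}_{g\circ\mu}}\le C\|\varphi\|_{\mathcal{M}_f}$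 for all $\varphi\in\mathcal{M}_f$. -/

import Mathlib

open Complex.UnitDisc

noncomputable section

namespace AnalyticDisc

/-- The open Euclidean unit ball of `ℂ^d`. -/
abbrev UnitBall (d : ℕ) : Type := Metric.ball (0 : EuclideanSpace ℂ (Fin d)) 1

/-! ### The Drury-Arveson space -/

/-- The weight `α! / |α|!` of a multi-index `α`. -/
def weight {d : ℕ} (α : Fin d → ℕ) : ℝ :=
  ((∏ i, (α i).factorial : ℕ) : ℝ) / (((∑ i, α i).factorial : ℕ) : ℝ)

lemma weight_nonneg {d : ℕ} (α : Fin d → ℕ) : 0 ≤ weight α := by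
  unfold weight; positivity

/-- The monomial `z ^ α`. -/
def monomial {d : ℕ} (α : Fin d → ℕ) (z : UnitBall d) : ℂ := ∏ i, (z.1 i) ^ (α i)

/-- `h(z) = ∑ c_α z^α` on the ball, with `∑ |c_α|² α! / |α|! < ∞`. -/
def IsExpansion {d : ℕ} (c : (Fin d → ℕ) → ℂ) (h : UnitBall d → ℂ) : Prop :=
  Summable (fun α => ‖c α‖ ^ 2 * weight α) ∧
    ∀ z, HasSum (fun α => c α * monomial α z) (h z)

/-- The Drury-Arveson space `H²_d`, as a space of functions on the ball. -/
def druryArveson (d : ℕ) : Submodule ℂ (UnitBall d → ℂ) where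
  carrier := {h | ∃ c, IsExpansion c h}
  zero_mem' := ⟨0, by simp [IsExpansion, summable_zero, hasSum_zero]⟩
  add_mem' := by
    rintro h k ⟨a, ha, ha'⟩ ⟨b, hb, hb'⟩
    refine ⟨a + b, ?_, fun z => ?_⟩
    · refine Summable.of_nonneg_of_le
        (fun α => mul_nonneg (by positivity) (weight_nonneg α)) (fun α => ?_)
        ((ha.add hb).mul_left 2)
      have h1 : ‖a α + b α‖ ^ 2 ≤ 2 * (‖a α‖ ^ 2 + ‖b α‖ ^ 2) := by
        have h2 := norm_add_le (a α) (b α)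
        have h3 := norm_nonneg (a α + b α)
        nlinarith [sq_nonneg (‖a α‖ - ‖b α‖)]
      calc ‖(a + b) α‖ ^ 2 * weight α
          ≤ 2 * (‖a α‖ ^ 2 + ‖b α‖ ^ 2) * weight α :=
            mul_le_mul_of_nonneg_right h1 (weight_nonneg α)
        _ = 2 * (‖a α‖ ^ 2 * weight α + ‖b α‖ ^ 2 * weight α) := by ring
    · simpa [add_mul] using (ha' z).add (hb' z)
  smul_mem' := by
    rintro t h ⟨a, ha, ha'⟩
    refine ⟨t • a, ?_, fun z => ?_⟩
    · refine (ha.mul_left (‖t‖ ^ 2)).congr fun α => ?_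
      simp only [Pi.smul_apply, smul_eq_mul, norm_mul]
      ring
    · simpa [mul_assoc] using (ha' z).mul_left t

/-- The norm of `H²_d`. The coefficients of a power series are determined by its sum, so the
infimum is over a single number when `h ∈ H²_d`. -/
def daNorm {d : ℕ} (h : UnitBall d → ℂ) : ℝ :=
  sInf {r | ∃ c, IsExpansion c h ∧ r = Real.sqrt (∑' α, ‖c α‖ ^ 2 * weight α)}

/-- The kernel function `k_w(z) = 1 / (1 - ⟨z, w⟩)`, with `⟨z, w⟩ = ∑ z_i conj(w_i)`
(Mathlib's inner product is conjugate-linear in its first argument). -/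
def kernelFun {d : ℕ} (w : UnitBall d) : UnitBall d → ℂ :=
  fun z => 1 / (1 - inner ℂ w.1 z.1)

/-! ### Multipliers and varieties -/

/-- The multiplier algebra of a linear space of functions. -/
def multiplierAlgebra {X : Type*} (H : Submodule ℂ (X → ℂ)) : Subalgebra ℂ (X → ℂ) where
  carrier := {φ | ∀ h ∈ H, φ * h ∈ H}
  mul_mem' := by
    intro φ ψ hφ hψ h hh
    rw [mul_assoc]
    exact hφ _ (hψ _ hh)
  add_mem' := by
    intro φ ψ hφ hψ h hh
    rw [add_mul]
    exact H.add_mem (hφ _ hh) (hψ _ hh)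
  algebraMap_mem' := by
    intro t h hh
    rw [← Algebra.smul_def]
    exact H.smul_mem t hh

/-- `M_d`, the multiplier algebra of `H²_d`. -/
def daMultipliers (d : ℕ) : Subalgebra ℂ (UnitBall d → ℂ) :=
  multiplierAlgebra (druryArveson d)

/-- A variety in the ball: a joint zero set of a family of functions from `M_d`. -/
def IsVariety {d : ℕ} (V : Set (UnitBall d)) : Prop :=
  ∃ E : Set (UnitBall d → ℂ), E ⊆ daMultipliers d ∧ V = {z | ∀ φ ∈ E, φ z = 0}

/-- Composition with a fixed map, as a homomorphism of function algebras. -/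
def precomp {X Y : Type*} (s : Y → X) : (X → ℂ) →ₐ[ℂ] (Y → ℂ) where
  toFun φ := φ ∘ s
  map_one' := rfl
  map_mul' _ _ := rfl
  map_zero' := rfl
  map_add' _ _ := rfl
  commutes' _ := rfl

/-- `M_V = {φ|_V : φ ∈ M_d}`. -/
def varietyAlgebra {d : ℕ} (V : Set (UnitBall d)) : Subalgebra ℂ (V → ℂ) :=
  (daMultipliers d).map (precomp (Subtype.val : V → UnitBall d))

/-- `H_V`, the closed linear span in `H²_d` of the kernel functions at the points of `V`. -/
def hilbertSpan {d : ℕ} (V : Set (UnitBall d)) : Set (UnitBall d → ℂ) :=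
  {h | h ∈ druryArveson d ∧
    ∀ ε > 0, ∃ p ∈ Submodule.span ℂ (kernelFun '' V), daNorm (h - p) < ε}

/-- `H_V`, regarded as a space of functions on `V`. -/
def varietySpace {d : ℕ} (V : Set (UnitBall d)) : Set (V → ℂ) :=
  {u | ∃ h ∈ hilbertSpan V, ∀ v : V, h v = u v}

/-- The norm of `H_V` on functions on `V`. An element of the closed span is determined by its
restriction to `V`, so the infimum is over a single number when `u ∈ H_V`. -/
def varietySpaceNorm {d : ℕ} (V : Set (UnitBall d)) (u : V → ℂ) : ℝ :=
  sInf {r | ∃ h ∈ hilbertSpan V, (∀ v : V, h v = u v) ∧ r = daNorm h}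

/-- The multiplier norm on `M_V`: the operator norm of `u ↦ φ u` on `H_V`. -/
def varietyAlgebraNorm {d : ℕ} (V : Set (UnitBall d)) (φ : V → ℂ) : ℝ :=
  sInf {C | 0 ≤ C ∧ ∀ u ∈ varietySpace V,
    varietySpaceNorm V (φ * u) ≤ C * varietySpaceNorm V u}

/-! ### Analytic discs attached to the unit sphere -/

/-- `V` is an analytic disc attached to the unit sphere, and `f` is an embedding map of `V`:
`V` is a variety, `f` is an injective analytic map of the disc into the ball with image `V` and
nowhere vanishing derivative, and `f` has an extension `F` to the closed disc that is `C²` up to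
the boundary, with `‖F x‖ = 1 ↔ |x| = 1`. Only the values of `F` on the closed disc matter. -/
structure IsEmbeddingMap {d : ℕ} (V : Set (UnitBall d)) (f : 𝔻 → UnitBall d) : Prop where
  isVariety : IsVariety V
  range_eq : Set.range f = V
  injective : Function.Injective f
  exists_extension : ∃ F : ℂ → EuclideanSpace ℂ (Fin d),
    (∀ z : 𝔻, F (z : ℂ) = (f z).1) ∧
    DifferentiableOn ℂ F (Metric.ball 0 1) ∧
    (∀ z ∈ Metric.ball (0 : ℂ) 1, deriv F z ≠ 0) ∧
    ContDiffOn ℝ 2 F (Metric.closedBall 0 1) ∧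
    ∀ x ∈ Metric.closedBall (0 : ℂ) 1, ‖F x‖ = 1 ↔ ‖x‖ = 1

/-- `M_f = {φ : 𝔻 → ℂ : φ ∘ f⁻¹ ∈ M_V}`, where `V = f(𝔻)` and `f` is injective
(`Set.rangeSplitting f` is then the inverse map `V → 𝔻` of `f`). -/
def discAlgebra {d : ℕ} (f : 𝔻 → UnitBall d) : Subalgebra ℂ (𝔻 → ℂ) :=
  (varietyAlgebra (Set.range f)).comap (precomp (Set.rangeSplitting f))

/-- `‖φ‖_{M_f} = ‖φ ∘ f⁻¹‖_{M_V}`. -/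
def discAlgebraNorm {d : ℕ} (f : 𝔻 → UnitBall d) (φ : 𝔻 → ℂ) : ℝ :=
  varietyAlgebraNorm (Set.range f) (φ ∘ Set.rangeSplitting f)

/-- A holomorphic map of the disc to itself. -/
def IsHolomorphicSelfMap (m : 𝔻 → 𝔻) : Prop :=
  ∃ F : ℂ → ℂ, (∀ z : 𝔻, F (z : ℂ) = (m z : ℂ)) ∧ DifferentiableOn ℂ F (Metric.ball 0 1)

/-- An automorphism of the disc: a bijection, holomorphic in both directions. -/
def IsDiscAutomorphism (m : 𝔻 ≃ 𝔻) : Prop :=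
  IsHolomorphicSelfMap m ∧ IsHolomorphicSelfMap m.symm

end AnalyticDisc

end

/-!
An isomorphism of the two algebras is composition with an automorphism of the disc, and the
uniform boundedness principle then makes the norms equivalent.

Let `Φ : M_f → M_g` be an isomorphism. For a point `z` of the disc, `ψ ↦ Φ (ψ ∘ f) z` is a
character of `M_d`; let `G z` be its values at the coordinate functions, which depend
holomorphically on `z`. Since the coordinates form a row contraction, `G z` is in the closed ball
(`norm_charPoint_le_one`). If `G` met the sphere, it would be constant by the maximum principle, and
then `f` would be this constant because `Φ` is injective. So `G z` is in the open ball, and the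
character is the evaluation at `G z` because the Gleason problem is solvable in `M_d`
(`exists_gleason`, `char_eq_eval`). As `V` is a zero set of multipliers, `G z` is in `V`, so that
`G = f ∘ m` and `Φ φ = φ ∘ m` (`exists_composition`). The map `m` is holomorphic since `f` is a
proper injective immersion (`IsEmbeddingMap.isHolomorphicSelfMap`). The inverse of `Φ` provides the
inverse of `m`.

For the norms, `H²_d` is modelled on `ℓ²(ℕ^d)` with kernel vectors `kvec z`, and a multiplier `φ` of
norm at most `C` on `H_V` is a function for which `kvec z ↦ conj (φ z) kvec z` is bounded by `C` on
the span of the kernel vectors at the points of `V` (`IsMultiplierBound`). By the Pick property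
(`mem_varietyAlgebra_iff`) all such functions are restrictions of multipliers of `H²_d`, so `M_V`
is a Banach algebra in its multiplier norm and the uniform boundedness principle compares two such
norms (`exists_isMultiplierBound_mul`).

Both the Pick property and the solution of the Gleason problem are cases of a factorization theorem
(`exists_multiplier_factorization`): if `(∑ aⱼ(z) conj aⱼ(w) - b(z) conj b(w)) k(z, w)` is positive
semidefinite on a set, then `b = ∑ aⱼ φⱼ` there, with contractive multipliers `φⱼ` of `H²_d`. It is
proved by the lurking isometry argument.
-/

noncomputable section

namespace AnalyticDisc

open scoped InnerProductSpace ComplexOrder ComplexConjugate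

/-! ### Gram matrices and contractions -/

section Gram

variable {ι H K : Type*} [NormedAddCommGroup H] [InnerProductSpace ℂ H]
  [NormedAddCommGroup K] [InnerProductSpace ℂ K]

lemma sum_star_mul_inner_mul (v : ι → H) (c : ι →₀ ℂ) :
    (c.sum fun i ci => c.sum fun j cj => star ci * ⟪v i, v j⟫_ℂ * cj) =
      ((‖Finsupp.linearCombination ℂ v c‖ ^ 2 : ℝ) : ℂ) := by
  rw [Complex.ofReal_pow, ← Complex.coe_algebraMap, ← inner_self_eq_norm_sq_to_K (𝕜 := ℂ),
    Finsupp.linearCombination_apply, Finsupp.sum_inner]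
  refine Finsupp.sum_congr fun i _ => ?_
  rw [inner_smul_left, Finsupp.inner_sum, Finsupp.mul_sum]
  refine Finsupp.sum_congr fun j _ => ?_
  rw [inner_smul_right, starRingEnd_apply]
  ring

lemma posSemidef_gram (v : ι → H) : (Matrix.gram ℂ v).PosSemidef := by
  refine ⟨Matrix.isHermitian_gram ℂ v, fun c => ?_⟩
  simp only [Matrix.gram_apply]
  rw [sum_star_mul_inner_mul]
  exact Complex.zero_le_real.2 (sq_nonneg _)

/-- Domination of Gram matrices, read off on linear combinations. -/
lemma posSemidef_gram_sub_gram_iff (x : ι → H) (y : ι → K) :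
    (Matrix.gram ℂ x - Matrix.gram ℂ y).PosSemidef ↔
      ∀ c, ‖Finsupp.linearCombination ℂ y c‖ ≤ ‖Finsupp.linearCombination ℂ x c‖ := by
  have key : ∀ c : ι →₀ ℂ, (c.sum fun i ci => c.sum fun j cj =>
      star ci * (Matrix.gram ℂ x - Matrix.gram ℂ y) i j * cj) =
      ((‖Finsupp.linearCombination ℂ x c‖ ^ 2 -
        ‖Finsupp.linearCombination ℂ y c‖ ^ 2 : ℝ) : ℂ) := by
    intro c
    rw [Complex.ofReal_sub, ← sum_star_mul_inner_mul, ← sum_star_mul_inner_mul]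
    simp only [Matrix.sub_apply, Matrix.gram_apply, mul_sub, sub_mul, Finsupp.sum_sub]
  constructor
  · intro h c
    have h1 := h.2 c
    rw [key, Complex.zero_le_real, sub_nonneg] at h1
    exact (pow_le_pow_iff_left₀ (norm_nonneg _) (norm_nonneg _) two_ne_zero).1 h1
  · intro h
    refine ⟨(Matrix.isHermitian_gram ℂ x).sub (Matrix.isHermitian_gram ℂ y), fun c => ?_⟩
    rw [key, Complex.zero_le_real, sub_nonneg]
    exact pow_le_pow_left₀ (norm_nonneg _) (h c) 2

lemma linearCombination_clm_apply (T : H →L[ℂ] K) (x : ι → H) (c : ι →₀ ℂ) :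
    Finsupp.linearCombination ℂ (fun i => T (x i)) c = T (Finsupp.linearCombination ℂ x c) := by
  simp only [Finsupp.linearCombination_apply, map_finsuppSum, map_smul]

lemma posSemidef_gram_sub_gram_apply (T : H →L[ℂ] K) {C : ℝ} (hC : 0 ≤ C)
    (hT : ∀ v, ‖T v‖ ≤ C * ‖v‖) (x : ι → H) :
    (Matrix.gram ℂ (fun i => (C : ℂ) • x i) - Matrix.gram ℂ fun i => T (x i)).PosSemidef := by
  refine (posSemidef_gram_sub_gram_iff _ _).2 fun c => ?_
  have h := linearCombination_clm_apply ((C : ℂ) • ContinuousLinearMap.id ℂ H) x c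
  simp only [smul_apply, ContinuousLinearMap.id_apply] at h
  rw [linearCombination_clm_apply, h, norm_smul, Complex.norm_real, Real.norm_of_nonneg hC]
  exact hT _

/-- Vectors whose linear combinations are dominated by those of `x` are the images of `x` under
a bounded operator, defined on the closed span of `x` by density and by zero on its orthogonal
complement. -/
lemma exists_clm_of_linearCombination_le [CompleteSpace H] [CompleteSpace K] (x : ι → H)
    (y : ι → K) {C : ℝ} (hC : 0 ≤ C)
    (h : ∀ c, ‖Finsupp.linearCombination ℂ y c‖ ≤ C * ‖Finsupp.linearCombination ℂ x c‖) :
    ∃ T : H →L[ℂ] K, (∀ v, ‖T v‖ ≤ C * ‖v‖) ∧ ∀ i, T (x i) = y i := by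
  set L := Finsupp.linearCombination ℂ x
  set p : Submodule ℂ H := (LinearMap.range L).topologicalClosure
  have : CompleteSpace p := (Submodule.isClosed_topologicalClosure _).completeSpace_coe
  let e : (ι →₀ ℂ) →ₗ[ℂ] p := L.codRestrict p fun c =>
    Submodule.le_topologicalClosure _ (LinearMap.mem_range_self L c)
  have he : DenseRange e := by
    rw [DenseRange, Subtype.dense_iff]
    intro v hv
    have h1 : Subtype.val '' Set.range e = (LinearMap.range L : Set H) := by
      ext w; simp [e]
    change v ∈ closure (Subtype.val '' Set.range e)
    rw [h1, ← Submodule.topologicalClosure_coe]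
    exact hv
  have hn : ∀ c, ‖Finsupp.linearCombination ℂ y c‖ ≤ C * ‖e c‖ := h
  refine ⟨((Finsupp.linearCombination ℂ y).extendOfNorm e).comp p.orthogonalProjectionOnto,
    fun v => ?_, fun i => ?_⟩
  · refine (LinearMap.norm_extendOfNorm_apply_le he C hn _).trans ?_
    exact mul_le_mul_of_nonneg_left (p.norm_orthogonalProjectionOnto_apply_le v) hC
  · have h1 : x i = (e (Finsupp.single i 1) : H) := by simp [e, L]
    rw [ContinuousLinearMap.comp_apply, h1, Submodule.orthogonalProjectionOnto_mem_subspace_eq_self,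
      LinearMap.extendOfNorm_eq he ⟨C, hn⟩]
    simp

/-- Vectors with equal Gram matrices correspond under a contraction. -/
lemma exists_contraction_of_gram_eq [CompleteSpace H] [CompleteSpace K] (x : ι → H)
    (y : ι → K) (h : ∀ i j, ⟪x i, x j⟫_ℂ = ⟪y i, y j⟫_ℂ) :
    ∃ T : H →L[ℂ] K, (∀ v, ‖T v‖ ≤ ‖v‖) ∧ ∀ i, T (x i) = y i := by
  have h1 : Matrix.gram ℂ x - Matrix.gram ℂ y = 0 := by
    ext i j; simp [h i j]
  have h2 := (posSemidef_gram_sub_gram_iff x y).1 (by rw [h1]; exact Matrix.PosSemidef.zero)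
  simpa using exists_clm_of_linearCombination_le x y zero_le_one (by simpa using h2)

end Gram

open RKHS in
/-- Every positive semidefinite scalar kernel is a Gram matrix. -/
lemma exists_gram_eq {X : Type} (M : Matrix X X ℂ) (hM : M.PosSemidef) :
    ∃ (H : Type) (_ : NormedAddCommGroup H) (_ : InnerProductSpace ℂ H) (_ : CompleteSpace H)
      (F : X → H), ∀ x y, ⟪F x, F y⟫_ℂ = M x y := by
  let N : Matrix X X (ℂ →L[ℂ] ℂ) := Matrix.of fun x y => M x y • ContinuousLinearMap.id ℂ ℂ
  have hN : N.PosSemidef := by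
    have hiff := (posSemidef_tfae (K := N)).out 0 2
    refine hiff.2 ⟨?_, fun v => ?_⟩
    · ext x y : 1
      simp only [N, Matrix.conjTranspose_apply, Matrix.of_apply, star_smul]
      rw [← Matrix.conjTranspose_apply, hM.1.eq, ContinuousLinearMap.star_eq_adjoint,
        ContinuousLinearMap.adjoint_id]
    · refine (Complex.le_def.1 (hM.2 v)).1.trans (le_of_eq ?_)
      rw [RCLike.re_eq_complex_re]
      congr 1
      refine Finsupp.sum_congr fun i _ => Finsupp.sum_congr fun j _ => ?_
      simp only [N, Matrix.of_apply, smul_apply, ContinuousLinearMap.id_apply,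
        RCLike.inner_apply, smul_eq_mul, map_mul]
      rw [← hM.1.apply i j, ← starRingEnd_apply, ← starRingEnd_apply]
      ring
  have : Fact N.PosSemidef := ⟨hN⟩
  refine ⟨OfKernel N, inferInstance, inferInstance, inferInstance,
    fun x => kerFun (OfKernel N) x 1, fun x y => ?_⟩
  rw [kerFun_inner, kerFun_apply, OfKernel.kernel_ofKernel]
  simp [N]

/-! ### Multipliers of a reproducing kernel Hilbert space -/

section Multiplier

variable {X H : Type*} [NormedAddCommGroup H] [InnerProductSpace ℂ H]

/-- The adjoint of multiplication by `φ`, acting on kernel vectors by `κ x ↦ conj (φ x) κ x`, is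
bounded by `C` on the span of the kernel vectors. -/
def IsMultiplierBound (κ : X → H) (φ : X → ℂ) (C : ℝ) : Prop :=
  ∀ c : X →₀ ℂ, ‖Finsupp.linearCombination ℂ (fun x => conj (φ x) • κ x) c‖ ≤
    C * ‖Finsupp.linearCombination ℂ κ c‖

/-- A function with a multiplier bound multiplies the functions `x ↦ ⟪κ x, v⟫`. -/
lemma IsMultiplierBound.exists_mul [CompleteSpace H] {κ : X → H} {φ : X → ℂ} {C : ℝ}
    (hC : 0 ≤ C) (h : IsMultiplierBound κ φ C) (v : H) :
    ∃ w : H, ‖w‖ ≤ C * ‖v‖ ∧ ∀ x, ⟪κ x, w⟫_ℂ = φ x * ⟪κ x, v⟫_ℂ := by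
  obtain ⟨T, hT, hTκ⟩ := exists_clm_of_linearCombination_le κ _ hC h
  refine ⟨T.adjoint v, ?_, fun x => ?_⟩
  · refine (T.adjoint.le_opNorm v).trans (mul_le_mul_of_nonneg_right ?_ (norm_nonneg _))
    rw [LinearIsometryEquiv.norm_map]
    exact T.opNorm_le_bound hC hT
  · rw [ContinuousLinearMap.adjoint_inner_right, hTκ, inner_smul_left, Complex.conj_conj]

lemma inner_linearCombination_conj_smul {κ : X → H} {φ : X → ℂ} {v w : H}
    (h : ∀ x, ⟪κ x, w⟫_ℂ = φ x * ⟪κ x, v⟫_ℂ) (c : X →₀ ℂ) :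
    ⟪Finsupp.linearCombination ℂ (fun x => conj (φ x) • κ x) c, v⟫_ℂ =
      ⟪Finsupp.linearCombination ℂ κ c, w⟫_ℂ := by
  simp only [Finsupp.linearCombination_apply, Finsupp.sum_inner]
  refine Finsupp.sum_congr fun x _ => ?_
  simp only [inner_smul_left, Complex.conj_conj, h]

/-- The multiplier bound, from the norms of the products with elements of the span of the kernel
vectors. -/
lemma isMultiplierBound_of_span {κ : X → H} {φ : X → ℂ} {C : ℝ}
    (h : ∀ v ∈ Submodule.span ℂ (Set.range κ), ∃ w : H, ‖w‖ ≤ C * ‖v‖ ∧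
      ∀ x, ⟪κ x, w⟫_ℂ = φ x * ⟪κ x, v⟫_ℂ) : IsMultiplierBound κ φ C := by
  intro c
  set v := Finsupp.linearCombination ℂ (fun x => conj (φ x) • κ x) c with hv
  have hmem : v ∈ Submodule.span ℂ (Set.range κ) := by
    rw [hv, Finsupp.linearCombination_apply]
    exact Submodule.sum_mem _ fun x _ => Submodule.smul_mem _ _ <|
      Submodule.smul_mem _ _ (Submodule.subset_span ⟨x, rfl⟩)
  obtain ⟨w, hw, hwφ⟩ := h v hmem
  have h1 := inner_linearCombination_conj_smul hwφ c
  rw [← hv, inner_self_eq_norm_sq_to_K] at h1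
  have h2 : ‖v‖ ^ 2 ≤ ‖Finsupp.linearCombination ℂ κ c‖ * (C * ‖v‖) := by
    have h3 := norm_inner_le_norm (𝕜 := ℂ) (Finsupp.linearCombination ℂ κ c) w
    rw [← h1] at h3
    have h4 : ‖((‖v‖ : ℂ)) ^ 2‖ = ‖v‖ ^ 2 := by simp
    exact h4.symm.le.trans (h3.trans (mul_le_mul_of_nonneg_left hw (norm_nonneg _)))
  rcases (norm_nonneg v).eq_or_lt with h0 | h0
  · obtain ⟨u, hu, -⟩ := h (Finsupp.linearCombination ℂ κ c) (by
      rw [← Finsupp.range_linearCombination]; exact LinearMap.mem_range_self _ c)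
    rw [← h0]; exact (norm_nonneg u).trans hu
  · nlinarith

/-- It suffices to bound the adjoint multiplication operator on vectors of norm at most one. -/
lemma isMultiplierBound_of_norm_le_one {κ : X → H} {φ : X → ℂ} {C : ℝ}
    (h : ∀ c : X →₀ ℂ, ‖Finsupp.linearCombination ℂ κ c‖ ≤ 1 →
      ‖Finsupp.linearCombination ℂ (fun x => conj (φ x) • κ x) c‖ ≤ C) :
    IsMultiplierBound κ φ C := by
  intro c
  set r := ‖Finsupp.linearCombination ℂ κ c‖ with hr
  set y := Finsupp.linearCombination ℂ (fun x => conj (φ x) • κ x) with hy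
  have hscale : ∀ t : ℝ, 0 < t → t * r ≤ 1 → t * ‖y c‖ ≤ C := by
    intro t ht htr
    have := h ((t : ℂ) • c) (by
      rw [map_smul, norm_smul, Complex.norm_real, Real.norm_of_nonneg ht.le]; exact htr)
    rwa [map_smul, norm_smul, Complex.norm_real, Real.norm_of_nonneg ht.le] at this
  rcases (norm_nonneg (Finsupp.linearCombination ℂ κ c)).eq_or_lt with h0 | h0
  · -- Here arbitrarily large multiples of `c` are admissible.
    rw [← hr] at h0
    rw [← h0, mul_zero]
    by_contra hcon
    push Not at hcon
    have hC : 0 ≤ C := by simpa using h 0 (by simp)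
    have := hscale ((C + 1) / ‖y c‖) (by positivity) (by rw [← h0]; simp)
    rw [div_mul_cancel₀ _ hcon.ne'] at this
    linarith
  · have := hscale r⁻¹ (inv_pos.2 h0) (by rw [inv_mul_cancel₀ h0.ne'])
    rwa [inv_mul_le_iff₀ h0, mul_comm] at this

/-- Multiplication by a multiplier is bounded, by the uniform boundedness principle. -/
lemma exists_isMultiplierBound [CompleteSpace H] {κ : X → H} {φ : X → ℂ}
    (h : ∀ v : H, ∃ w : H, ∀ x, ⟪κ x, w⟫_ℂ = φ x * ⟪κ x, v⟫_ℂ) :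
    ∃ C, 0 ≤ C ∧ IsMultiplierBound κ φ C := by
  let I := {c : X →₀ ℂ // ‖Finsupp.linearCombination ℂ κ c‖ ≤ 1}
  let y : (X →₀ ℂ) →ₗ[ℂ] H := Finsupp.linearCombination ℂ (fun x => conj (φ x) • κ x)
  have hbd : ∀ v : H, ∃ B, ∀ c : I, ‖innerSL ℂ (y c.1) v‖ ≤ B := by
    intro v
    obtain ⟨w, hw⟩ := h v
    refine ⟨‖w‖, fun c => ?_⟩
    rw [innerSL_apply_apply, inner_linearCombination_conj_smul hw]
    refine (norm_inner_le_norm _ _).trans ?_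
    exact mul_le_of_le_one_left (norm_nonneg _) c.2
  obtain ⟨C, hC⟩ := banach_steinhaus hbd
  refine ⟨C, (norm_nonneg _).trans (hC ⟨0, by simp⟩),
    isMultiplierBound_of_norm_le_one fun c hc => ?_⟩
  simpa using hC ⟨c, hc⟩

lemma isMultiplierBound_iff_posSemidef (κ : X → H) (φ : X → ℂ) {C : ℝ} (hC : 0 ≤ C) :
    IsMultiplierBound κ φ C ↔
      (Matrix.of fun x y => ((C : ℂ) ^ 2 - φ x * conj (φ y)) * ⟪κ x, κ y⟫_ℂ).PosSemidef := by
  have h := posSemidef_gram_sub_gram_iff (fun x => (C : ℂ) • κ x) (fun x => conj (φ x) • κ x)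
  have h1 : Matrix.gram ℂ (fun x => (C : ℂ) • κ x) - Matrix.gram ℂ (fun x => conj (φ x) • κ x) =
      Matrix.of fun x y => ((C : ℂ) ^ 2 - φ x * conj (φ y)) * ⟪κ x, κ y⟫_ℂ := by
    ext x y
    simp only [Matrix.sub_apply, Matrix.gram_apply, Matrix.of_apply, inner_smul_left,
      inner_smul_right, Complex.conj_conj, Complex.conj_ofReal]
    ring
  rw [← h1, h]
  refine forall_congr' fun c => ?_
  have h2 := linearCombination_clm_apply ((C : ℂ) • ContinuousLinearMap.id ℂ H) κ c
  simp only [smul_apply, ContinuousLinearMap.id_apply] at h2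
  rw [h2, norm_smul, Complex.norm_real, Real.norm_of_nonneg hC]

lemma IsMultiplierBound.comp {Y : Type*} {κ : X → H} {φ : X → ℂ} {C : ℝ}
    (h : IsMultiplierBound κ φ C) (s : Y → X) :
    IsMultiplierBound (fun y => κ (s y)) (fun y => φ (s y)) C := by
  intro c
  have h1 := h (c.mapDomain s)
  rwa [Finsupp.linearCombination_mapDomain, Finsupp.linearCombination_mapDomain] at h1

lemma exists_linearCombination_smul (s : X → ℂ) (c : X →₀ ℂ) :
    ∃ b : X →₀ ℂ, ∀ y : X → H, Finsupp.linearCombination ℂ y b =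
      Finsupp.linearCombination ℂ (fun x => s x • y x) c := by
  refine ⟨Finsupp.linearCombination ℂ (fun x => s x • Finsupp.single x (1 : ℂ)) c, fun y => ?_⟩
  rw [Finsupp.apply_linearCombination]
  congr 2
  ext x
  simp

/-- If `φ` is a contractive multiplier and `|μ| > 1`, then `1 / (μ - φ)` is a multiplier. -/
lemma IsMultiplierBound.resolvent {κ : X → H} {φ : X → ℂ} (h : IsMultiplierBound κ φ 1) {μ : ℂ}
    (hμ : 1 < ‖μ‖) (hφ : ∀ x, μ - φ x ≠ 0) :
    IsMultiplierBound κ (fun x => (μ - φ x)⁻¹) (‖μ‖ - 1)⁻¹ := by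
  intro c
  obtain ⟨b, hb⟩ := exists_linearCombination_smul (H := H) (fun x => conj (μ - φ x)⁻¹) c
  rw [← hb κ]
  have h1 : Finsupp.linearCombination ℂ κ c = conj μ • Finsupp.linearCombination ℂ κ b -
      Finsupp.linearCombination ℂ (fun x => conj (φ x) • κ x) b := by
    rw [hb, hb]
    simp only [Finsupp.linearCombination_apply, Finsupp.smul_sum, ← Finsupp.sum_sub]
    refine Finsupp.sum_congr fun x _ => ?_
    have h2 : conj μ * conj (μ - φ x)⁻¹ - conj (μ - φ x)⁻¹ * conj (φ x) = 1 := by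
      rw [← map_mul, ← map_mul, ← map_sub, mul_comm, ← mul_sub, inv_mul_cancel₀ (hφ x), map_one]
    rw [smul_comm (conj μ), ← smul_sub, smul_smul, smul_smul, ← sub_smul, h2, one_smul]
  have h3 := h b
  have h4 := norm_sub_norm_le (conj μ • Finsupp.linearCombination ℂ κ b)
    (Finsupp.linearCombination ℂ (fun x => conj (φ x) • κ x) b)
  rw [← h1, norm_smul, RCLike.norm_conj] at h4
  rw [le_inv_mul_iff₀ (sub_pos.2 hμ)]
  linarith

end Multiplier

/-! ### The closed span of the kernel vectors -/

section KernelSpan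

variable {X H : Type*} [NormedAddCommGroup H] [InnerProductSpace ℂ H]

/-- The closed linear span of the kernel vectors. -/
def kernelSpan (κ : X → H) : Submodule ℂ H := (Submodule.span ℂ (Set.range κ)).topologicalClosure

lemma mem_kernelSpan (κ : X → H) (x : X) : κ x ∈ kernelSpan κ :=
  Submodule.le_topologicalClosure _ (Submodule.subset_span ⟨x, rfl⟩)

lemma inner_eq_zero_of_mem_kernelSpan {κ : X → H} {u v : H} (hv : v ∈ kernelSpan κ)
    (hu : ∀ x, ⟪κ x, u⟫_ℂ = 0) : ⟪v, u⟫_ℂ = 0 := by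
  have h1 : u ∈ (Submodule.span ℂ (Set.range κ))ᗮ := by
    rw [Submodule.mem_orthogonal]
    intro w hw
    induction hw using Submodule.span_induction with
    | mem w hw => obtain ⟨x, rfl⟩ := hw; exact hu x
    | zero => simp
    | add a b _ _ ha hb => rw [inner_add_left, ha, hb, add_zero]
    | smul t a _ ha => rw [inner_smul_left, ha, mul_zero]
  rw [← Submodule.orthogonal_closure] at h1
  exact (Submodule.mem_orthogonal _ _).1 h1 v hv

/-- Elements of the closed span of the kernel vectors have the least norm among the vectors that
define the same function. -/
lemma norm_le_of_mem_kernelSpan {κ : X → H} {u v : H} (hv : v ∈ kernelSpan κ)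
    (h : ∀ x, ⟪κ x, u⟫_ℂ = ⟪κ x, v⟫_ℂ) : ‖v‖ ≤ ‖u‖ := by
  have h1 : ⟪v, u - v⟫_ℂ = 0 := inner_eq_zero_of_mem_kernelSpan hv fun x => by
    rw [inner_sub_right, h, sub_self]
  have h2 := norm_add_sq_eq_norm_sq_add_norm_sq_of_inner_eq_zero v (u - v) h1
  rw [add_sub_cancel] at h2
  nlinarith [norm_nonneg v, norm_nonneg u, norm_nonneg (u - v)]

lemma eq_of_mem_kernelSpan {κ : X → H} {u v : H} (hu : u ∈ kernelSpan κ) (hv : v ∈ kernelSpan κ)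
    (h : ∀ x, ⟪κ x, u⟫_ℂ = ⟪κ x, v⟫_ℂ) : u = v := by
  have h1 : ⟪u - v, u - v⟫_ℂ = 0 :=
    inner_eq_zero_of_mem_kernelSpan (Submodule.sub_mem _ hu hv) fun x => by
      rw [inner_sub_right, h, sub_self]
  exact sub_eq_zero.1 (inner_self_eq_zero.1 h1)

/-- Every vector defines the same function as its projection to the closed span of the kernel
vectors. -/
lemma exists_mem_kernelSpan [CompleteSpace H] (κ : X → H) (u : H) :
    ∃ v ∈ kernelSpan κ, ‖v‖ ≤ ‖u‖ ∧ ∀ x, ⟪κ x, v⟫_ℂ = ⟪κ x, u⟫_ℂ := by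
  have : CompleteSpace (kernelSpan κ) :=
    (Submodule.isClosed_topologicalClosure _).completeSpace_coe
  refine ⟨(kernelSpan κ).orthogonalProjectionOnto u, Subtype.mem _,
    (kernelSpan κ).norm_orthogonalProjectionOnto_apply_le u, fun x => ?_⟩
  have h2 := (kernelSpan κ).sub_starProjection_mem_orthogonal u
  have h3 := (Submodule.mem_orthogonal _ _).1 h2 _ (mem_kernelSpan κ x)
  rw [inner_sub_right, sub_eq_zero] at h3
  exact h3.symm

end KernelSpan

/-! ### The kernel vectors of the Drury-Arveson space -/

variable {d : ℕ}

lemma weight_pos (α : Fin d → ℕ) : 0 < weight α := by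
  unfold weight
  have := Finset.prod_pos fun i (_ : i ∈ Finset.univ) => Nat.factorial_pos (α i)
  have := Nat.factorial_pos (∑ i, α i)
  positivity

lemma inv_weight (α : Fin d → ℕ) : (weight α)⁻¹ = Nat.multinomial Finset.univ α := by
  have h := Nat.multinomial_spec Finset.univ α
  have h1 := Finset.prod_pos fun i (_ : i ∈ Finset.univ) => Nat.factorial_pos (α i)
  rw [weight, inv_div, ← h]
  push_cast at h1 ⊢
  rw [mul_div_cancel_left₀]
  exact_mod_cast h1.ne'

lemma hasSum_fiber_multinomial {R : Type*} [NormedField R] (x : Fin d → R) (n : ℕ) :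
    HasSum (fun α : {α : Fin d → ℕ // ∑ i, α i = n} =>
      (Nat.multinomial Finset.univ α.1 : R) * ∏ i, x i ^ α.1 i) ((∑ i, x i) ^ n) := by
  rw [Finset.sum_pow_eq_sum_piAntidiag]
  have h := (Finset.piAntidiag Finset.univ n).hasSum
    fun α : Fin d → ℕ => (Nat.multinomial Finset.univ α : R) * ∏ i, x i ^ α i
  refine ((Equiv.subtypeEquivRight fun α => ?_).hasSum_iff).1 h
  simp

/-- The multinomial expansion of the geometric series. -/
lemma hasSum_multinomial (x : Fin d → ℂ) (hx : ∑ i, ‖x i‖ < 1) :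
    HasSum (fun α : Fin d → ℕ => (Nat.multinomial Finset.univ α : ℂ) * ∏ i, x i ^ α i)
      (1 / (1 - ∑ i, x i)) := by
  let e := Equiv.sigmaFiberEquiv fun α : Fin d → ℕ => ∑ i, α i
  have hsum : Summable fun α : Fin d → ℕ =>
      (Nat.multinomial Finset.univ α : ℂ) * ∏ i, x i ^ α i := by
    refine Summable.of_norm ?_
    have h0 : (fun α : Fin d → ℕ => ‖(Nat.multinomial Finset.univ α : ℂ) * ∏ i, x i ^ α i‖) =
        fun α => (Nat.multinomial Finset.univ α : ℝ) * ∏ i, ‖x i‖ ^ α i := by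
      ext α; simp
    rw [h0, ← e.summable_iff, summable_sigma_of_nonneg (fun _ => by simp; positivity)]
    refine ⟨fun n => (hasSum_fiber_multinomial (fun i => ‖x i‖) n).summable, ?_⟩
    have h1 := fun n => (hasSum_fiber_multinomial (fun i => ‖x i‖) n).tsum_eq
    refine (summable_geometric_of_lt_one (Finset.sum_nonneg fun i _ => norm_nonneg (x i))
      hx).congr fun n => ?_
    exact (h1 n).symm
  have hnorm : ‖∑ i, x i‖ < 1 := (norm_sum_le _ _).trans_lt hx
  have h2 := (e.hasSum_iff.2 hsum.hasSum).sigma fun n => hasSum_fiber_multinomial x n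
  rw [one_div, (hasSum_geometric_of_norm_lt_one hnorm).unique h2]
  exact hsum.hasSum

lemma sum_norm_mul_lt_one (z w : UnitBall d) : ∑ i, ‖z.1 i * conj (w.1 i)‖ < 1 := by
  have hz := mem_ball_zero_iff.1 z.2
  have hw := mem_ball_zero_iff.1 w.2
  simp only [norm_mul, RCLike.norm_conj]
  refine (Real.sum_mul_le_sqrt_mul_sqrt _ _ _).trans_lt ?_
  rw [← EuclideanSpace.norm_eq, ← EuclideanSpace.norm_eq]
  nlinarith [norm_nonneg z.1, norm_nonneg w.1]

lemma sum_mul_conj_eq_inner (z w : EuclideanSpace ℂ (Fin d)) :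
    ∑ i, z i * conj (w i) = ⟪w, z⟫_ℂ := by
  simp [PiLp.inner_apply]

/-- `∑ z^α conj(w^α) |α|! / α! = 1 / (1 - ⟨z, w⟩)`. -/
lemma hasSum_kernel (z w : UnitBall d) :
    HasSum (fun α => monomial α z * conj (monomial α w) / weight α) (kernelFun w z) := by
  have h := hasSum_multinomial _ (sum_norm_mul_lt_one z w)
  rw [sum_mul_conj_eq_inner] at h
  refine h.congr_fun fun α => ?_
  have h1 : ((weight α : ℂ))⁻¹ = (Nat.multinomial Finset.univ α : ℂ) := by
    exact_mod_cast congrArg (fun r : ℝ => (r : ℂ)) (inv_weight α)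
  rw [div_eq_mul_inv, h1, mul_comm]
  simp only [monomial, map_prod, map_pow, mul_pow, Finset.prod_mul_distrib]

lemma sqrt_weight_ne_zero (α : Fin d → ℕ) : ((√(weight α) : ℝ) : ℂ) ≠ 0 :=
  Complex.ofReal_ne_zero.2 (Real.sqrt_pos.2 (weight_pos α)).ne'

lemma sqrt_weight_mul_self (α : Fin d → ℕ) :
    ((√(weight α) : ℝ) : ℂ) * (√(weight α) : ℝ) = weight α := by
  rw [← Complex.ofReal_mul, Real.mul_self_sqrt (weight_nonneg α)]

/-- The kernel vectors of the Drury-Arveson space in the model `ℓ²(ℕ^d)`, in which the function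
`∑ c_α z^α` is represented by `α ↦ c_α √(α! / |α|!)`. -/
def kvec (z : UnitBall d) : lp (fun _ : Fin d → ℕ => ℂ) 2 :=
  ⟨fun α => conj (monomial α z) / (√(weight α) : ℝ), by
    refine memℓp_gen ?_
    have h := (hasSum_kernel z z).summable.norm
    refine h.congr fun α => ?_
    rw [← sqrt_weight_mul_self]
    simp only [norm_div, norm_mul, RCLike.norm_conj, ENNReal.toReal_ofNat, Real.rpow_ofNat]
    rw [div_pow, sq, sq]⟩

lemma kvec_apply (z : UnitBall d) (α : Fin d → ℕ) :
    kvec z α = conj (monomial α z) / (√(weight α) : ℝ) := rfl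

lemma inner_kvec (z w : UnitBall d) : ⟪kvec z, kvec w⟫_ℂ = kernelFun w z := by
  refine (lp.hasSum_inner (kvec z) (kvec w)).unique ((hasSum_kernel z w).congr_fun fun α => ?_)
  rw [kvec_apply, kvec_apply, RCLike.inner_apply, map_div₀, Complex.conj_conj, Complex.conj_ofReal,
    ← sqrt_weight_mul_self, div_mul_div_comm, mul_comm (monomial α z)]

lemma norm_inner_lt_one (z w : UnitBall d) : ‖⟪w.1, z.1⟫_ℂ‖ < 1 := by
  have hz := mem_ball_zero_iff.1 z.2
  have hw := mem_ball_zero_iff.1 w.2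
  refine (norm_inner_le_norm _ _).trans_lt ?_
  nlinarith [norm_nonneg z.1, norm_nonneg w.1]

lemma one_sub_inner_ne_zero (z w : UnitBall d) : 1 - ⟪w.1, z.1⟫_ℂ ≠ 0 := by
  intro h
  have h1 := norm_inner_lt_one z w
  rw [← sub_eq_zero.1 h] at h1
  simp at h1

lemma one_sub_inner_mul_inner_kvec (z w : UnitBall d) :
    (1 - ⟪w.1, z.1⟫_ℂ) * ⟪kvec z, kvec w⟫_ℂ = 1 := by
  rw [inner_kvec, kernelFun, mul_one_div_cancel (one_sub_inner_ne_zero z w)]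

lemma hasSum_inner_kvec (z : UnitBall d) (v : lp (fun _ : Fin d → ℕ => ℂ) 2) :
    HasSum (fun α => v α / (√(weight α) : ℝ) * monomial α z) ⟪kvec z, v⟫_ℂ := by
  refine (lp.hasSum_inner (kvec z) v).congr_fun fun α => ?_
  rw [kvec_apply, RCLike.inner_apply, map_div₀, Complex.conj_conj, Complex.conj_ofReal]
  ring

lemma norm_mul_sqrt_weight_sq (c : ℂ) (α : Fin d → ℕ) :
    ‖c * (√(weight α) : ℝ)‖ ^ 2 = ‖c‖ ^ 2 * weight α := by
  rw [norm_mul, Complex.norm_real, Real.norm_of_nonneg (Real.sqrt_nonneg _), mul_pow,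
    Real.sq_sqrt (weight_nonneg α)]

lemma hasSum_norm_sq (v : lp (fun _ : Fin d → ℕ => ℂ) 2) :
    HasSum (fun α => ‖v α‖ ^ 2) (‖v‖ ^ 2) := by
  have h := lp.hasSum_norm (p := 2) (by simp) v
  simpa using h

/-- Expansions with square summable weighted coefficients are vectors of the model. -/
lemma exists_isExpansion_iff (h : UnitBall d → ℂ) (r : ℝ) :
    (∃ c, IsExpansion c h ∧ r = √(∑' α, ‖c α‖ ^ 2 * weight α)) ↔
      ∃ v : lp (fun _ : Fin d → ℕ => ℂ) 2, (∀ z, ⟪kvec z, v⟫_ℂ = h z) ∧ r = ‖v‖ := by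
  constructor
  · rintro ⟨c, ⟨hc, hh⟩, rfl⟩
    let v : lp (fun _ : Fin d → ℕ => ℂ) 2 := ⟨fun α => c α * (√(weight α) : ℝ), by
      refine memℓp_gen (hc.congr fun α => ?_)
      rw [← norm_mul_sqrt_weight_sq]
      simp⟩
    have hv : ∀ α, v α = c α * (√(weight α) : ℝ) := fun α => rfl
    refine ⟨v, fun z => ?_, ?_⟩
    · refine (hasSum_inner_kvec z v).unique ((hh z).congr_fun fun α => ?_)
      rw [hv, mul_div_cancel_right₀ _ (sqrt_weight_ne_zero α)]
    · rw [← Real.sqrt_sq (norm_nonneg v), ← (hasSum_norm_sq v).tsum_eq]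
      simp only [hv, norm_mul_sqrt_weight_sq]
  · rintro ⟨v, hv, rfl⟩
    have hc : ∀ α, ‖v α / (√(weight α) : ℝ)‖ ^ 2 * weight α = ‖v α‖ ^ 2 := fun α => by
      rw [← norm_mul_sqrt_weight_sq, div_mul_cancel₀ _ (sqrt_weight_ne_zero α)]
    refine ⟨fun α => v α / (√(weight α) : ℝ), ⟨?_, fun z => ?_⟩, ?_⟩
    · simp only [hc]
      exact (hasSum_norm_sq v).summable
    · rw [← hv z]
      exact hasSum_inner_kvec z v
    · simp only [hc]
      rw [(hasSum_norm_sq v).tsum_eq, Real.sqrt_sq (norm_nonneg v)]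

lemma mem_druryArveson_iff (h : UnitBall d → ℂ) :
    h ∈ druryArveson d ↔ ∃ v, ∀ z, ⟪kvec z, v⟫_ℂ = h z := by
  constructor
  · rintro ⟨c, hc⟩
    obtain ⟨v, hv, -⟩ := (exists_isExpansion_iff h _).1 ⟨c, hc, rfl⟩
    exact ⟨v, hv⟩
  · rintro ⟨v, hv⟩
    obtain ⟨c, hc, -⟩ := (exists_isExpansion_iff h _).2 ⟨v, hv, rfl⟩
    exact ⟨c, hc⟩

/-- The norm of `H²_d` is the norm of the representing vector in the closed span of the kernel
vectors. (That span is in fact the whole space, but this is not needed.) -/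
lemma daNorm_eq {h : UnitBall d → ℂ} {v : lp (fun _ : Fin d → ℕ => ℂ) 2}
    (hv : v ∈ kernelSpan (kvec (d := d))) (hvh : ∀ z, ⟪kvec z, v⟫_ℂ = h z) : daNorm h = ‖v‖ := by
  unfold daNorm
  simp only [exists_isExpansion_iff]
  refine IsLeast.csInf_eq ⟨⟨v, hvh, rfl⟩, ?_⟩
  rintro _ ⟨u, hu, rfl⟩
  exact norm_le_of_mem_kernelSpan hv fun z => by rw [hu, hvh]

/-! ### Factorization of kernels by contractive multipliers -/

section Leech

variable {ι : Type} [Fintype ι] {H : Type} [NormedAddCommGroup H] [InnerProductSpace ℂ H]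

/-- The vector `s ⊕ (conj z₁ h, …, conj z_d h)`, depending linearly on `(s, h)`. -/
def ballTensor (z : UnitBall d) : (EuclideanSpace ℂ ι × H) →ₗ[ℂ]
    WithLp 2 (EuclideanSpace ℂ ι × PiLp 2 (fun _ : Fin d => H)) where
  toFun p := WithLp.toLp 2 (p.1, WithLp.toLp 2 fun i => conj (z.1 i) • p.2)
  map_add' p q := by
    rw [← WithLp.toLp_add, Prod.mk_add_mk, ← WithLp.toLp_add]
    congr 3
    ext i : 1
    exact smul_add _ _ _
  map_smul' t p := by
    rw [RingHom.id_apply, ← WithLp.toLp_smul, Prod.smul_mk, ← WithLp.toLp_smul]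
    congr 3
    ext i : 1
    exact smul_comm _ _ _

lemma inner_ballTensor (z w : UnitBall d) (p q : EuclideanSpace ℂ ι × H) :
    ⟪ballTensor z p, ballTensor w q⟫_ℂ = ⟪p.1, q.1⟫_ℂ + ⟪w.1, z.1⟫_ℂ * ⟪p.2, q.2⟫_ℂ := by
  rw [← sum_mul_conj_eq_inner, Finset.sum_mul, WithLp.prod_inner_apply]
  congr 1
  rw [PiLp.inner_apply]
  refine Finset.sum_congr rfl fun i _ => ?_
  change ⟪conj (z.1 i) • p.2, conj (w.1 i) • q.2⟫_ℂ = _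
  rw [inner_smul_left, inner_smul_right, Complex.conj_conj, mul_assoc]

lemma norm_ballTensor_zero (z : UnitBall d) (h : H) :
    ‖ballTensor z ((0 : EuclideanSpace ℂ ι), h)‖ = ‖z.1‖ * ‖h‖ := by
  rw [← sq_eq_sq₀ (norm_nonneg _) (by positivity)]
  have h1 := inner_ballTensor z z ((0 : EuclideanSpace ℂ ι), h) (0, h)
  rw [inner_zero_left, zero_add, inner_self_eq_norm_sq_to_K, inner_self_eq_norm_sq_to_K,
    inner_self_eq_norm_sq_to_K] at h1
  rw [mul_pow]
  exact_mod_cast h1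

variable (U : WithLp 2 (EuclideanSpace ℂ ι × PiLp 2 (fun _ : Fin d => H)) →L[ℂ] WithLp 2 (ℂ × H))
  (hU : ∀ v, ‖U v‖ ≤ ‖v‖)

include hU in
lemma norm_snd_ballTensor_zero_le (z : UnitBall d) (h : H) :
    ‖(U (ballTensor z ((0 : EuclideanSpace ℂ ι), h))).snd‖ ≤ ‖z.1‖ * ‖h‖ := by
  refine le_trans ?_ ((hU _).trans_eq (norm_ballTensor_zero z h))
  rw [← sq_le_sq₀ (norm_nonneg _) (norm_nonneg _), WithLp.prod_norm_sq_eq_of_L2]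
  exact le_add_of_nonneg_left (sq_nonneg _)

include hU in
/-- The state equation of the contraction `U` has a solution at every point of the ball. -/
lemma exists_state [CompleteSpace H] (z : UnitBall d) (s : EuclideanSpace ℂ ι) :
    ∃ h : H, (U (ballTensor z (s, h))).snd = h := by
  have hc : ContractingWith ⟨‖z.1‖, norm_nonneg _⟩
      fun h : H => (U (ballTensor z (s, h))).snd := by
    refine ⟨mem_ball_zero_iff.1 z.2, LipschitzWith.of_dist_le_mul fun h k => ?_⟩
    rw [dist_eq_norm, dist_eq_norm, ← WithLp.sub_snd, ← map_sub, ← map_sub, Prod.mk_sub_mk,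
      sub_self]
    exact norm_snd_ballTensor_zero_le U hU z (h - k)
  exact ⟨_, hc.fixedPoint_isFixedPt⟩

include hU in
lemma state_unique (z : UnitBall d) (s : EuclideanSpace ℂ ι) {h k : H}
    (hh : (U (ballTensor z (s, h))).snd = h) (hk : (U (ballTensor z (s, k))).snd = k) : h = k := by
  have h1 : (U (ballTensor z ((0 : EuclideanSpace ℂ ι), h - k))).snd = h - k := by
    have : ((0 : EuclideanSpace ℂ ι), h - k) = (s, h) - (s, k) := by simp
    rw [this, map_sub, map_sub, WithLp.sub_snd, hh, hk]
  have h2 := norm_snd_ballTensor_zero_le U hU z (h - k)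
  rw [h1] at h2
  have h3 := mem_ball_zero_iff.1 z.2
  rw [← sub_eq_zero, ← norm_eq_zero]
  nlinarith [norm_nonneg (h - k)]

include hU in
/-- The transfer function of a contraction is a contractive multiplier of `H²_d`. -/
lemma isMultiplierBound_transfer (s : EuclideanSpace ℂ ι) (hs : ‖s‖ = 1) (G : UnitBall d → H)
    (hG : ∀ z, (U (ballTensor z (s, G z))).snd = G z) :
    IsMultiplierBound kvec (fun z => conj (U (ballTensor z (s, G z))).fst) 1 := by
  set x := fun z : UnitBall d => ballTensor z (s, G z) with hx
  rw [isMultiplierBound_iff_posSemidef _ _ zero_le_one]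
  have h1 : (Matrix.gram ℂ x - Matrix.gram ℂ fun z => U (x z)).PosSemidef := by
    simpa using posSemidef_gram_sub_gram_apply U zero_le_one (by simpa using hU) x
  have h3 := (h1.hadamard (posSemidef_gram (kvec (d := d)))).add (posSemidef_gram G)
  convert! h3 using 1
  ext z w
  have hk := one_sub_inner_mul_inner_kvec z w
  have hss : ⟪s, s⟫_ℂ = 1 := by rw [inner_self_eq_norm_sq_to_K, hs]; simp
  simp only [Matrix.of_apply, Matrix.add_apply, Matrix.hadamard_apply, Matrix.sub_apply,
    Matrix.gram_apply]
  rw [WithLp.prod_inner_apply (U (x z))]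
  simp only [hx, inner_ballTensor, hss]
  have hf : ∀ v : WithLp 2 (ℂ × H), (WithLp.ofLp v).1 = v.fst := fun _ => rfl
  have hf' : ∀ v : WithLp 2 (ℂ × H), (WithLp.ofLp v).2 = v.snd := fun _ => rfl
  simp only [hf, hf', hG, RCLike.inner_apply, Complex.conj_conj, Complex.ofReal_one]
  linear_combination ⟪G z, G w⟫_ℂ * hk

end Leech

/-- If `(∑ aⱼ(z) conj aⱼ(w) - b(z) conj b(w)) k(z, w)` is positive semidefinite on a subset of the
ball, then `b = ∑ aⱼ φⱼ` there, with contractive multipliers `φⱼ` of `H²_d`. A Gram representation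
`⟪F z, F w⟫` of this kernel turns it into an equality of two Gram matrices, and the `φⱼ` are the
transfer functions of the contraction between the corresponding vectors. -/
theorem exists_multiplier_factorization {d : ℕ} {ι : Type} [Fintype ι] (V : Set (UnitBall d))
    (a : ι → UnitBall d → ℂ) (b : UnitBall d → ℂ)
    (h : (Matrix.of fun z w : V => (∑ j, a j z * conj (a j w) - b z * conj (b w)) *
      ⟪kvec z.1, kvec w.1⟫_ℂ).PosSemidef) :
    ∃ φ : ι → UnitBall d → ℂ, (∀ j, IsMultiplierBound kvec (φ j) 1) ∧
      ∀ z ∈ V, b z = ∑ j, a j z * φ j z := by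
  classical
  obtain ⟨H, _, _, _, F, hF⟩ := exists_gram_eq _ h
  let A : UnitBall d → EuclideanSpace ℂ ι := fun z => WithLp.toLp 2 fun j => conj (a j z)
  obtain ⟨U, hU, hUx⟩ := exists_contraction_of_gram_eq
    (fun z : V => ballTensor z.1 (A z, F z))
    (fun z : V => WithLp.toLp 2 (conj (b z), F z)) (by
      intro z w
      have hk := one_sub_inner_mul_inner_kvec z.1 w.1
      have hA : ⟪A z, A w⟫_ℂ = ∑ j, a j z.1 * conj (a j w.1) := by
        rw [PiLp.inner_apply]
        exact Finset.sum_congr rfl fun j _ => by simp [A, mul_comm]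
      rw [inner_ballTensor, WithLp.prod_inner_apply]
      simp only [hF, Matrix.of_apply, hA, RCLike.inner_apply, Complex.conj_conj]
      linear_combination (b z.1 * conj (b w.1) - ∑ j, a j z.1 * conj (a j w.1)) * hk)
  have hst := fun (j : ι) (z : UnitBall d) =>
    exists_state U hU z (EuclideanSpace.single j (1 : ℂ))
  choose G hG using hst
  refine ⟨fun j z => conj (U (ballTensor z (EuclideanSpace.single j (1 : ℂ), G j z))).fst,
    fun j => isMultiplierBound_transfer U hU _ (by simp) (G j) (hG j), fun z hz => ?_⟩
  -- By linearity and uniqueness, the state at a point of `V` is a combination of the `G j z`.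
  have hlin : ∀ k : H, k = ∑ j, conj (a j z) • G j z → ballTensor z (A z, k) =
      ∑ j, conj (a j z) • ballTensor z (EuclideanSpace.single j (1 : ℂ), G j z) := by
    rintro _ rfl
    simp only [← map_smul, ← map_sum]
    congr 1
    refine Prod.ext ?_ ?_
    · rw [Prod.fst_sum]
      ext i
      simp [A, Pi.single_apply]
    · rw [Prod.snd_sum]
      rfl
  have hx := hUx ⟨z, hz⟩
  have hFG : F ⟨z, hz⟩ = ∑ j, conj (a j z) • G j z := by
    refine state_unique U hU z (A z) ?_ ?_
    · exact congrArg WithLp.snd hx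
    · rw [hlin _ rfl]
      simp only [map_sum, map_smul]
      have : ∀ v : WithLp 2 (ℂ × H), v.snd = WithLp.sndL 2 ℂ ℂ H v := fun _ => rfl
      simp only [this, map_sum, map_smul]
      simp only [← this, hG]
  have hb := congrArg WithLp.fst hx
  have hfst : ∀ v : WithLp 2 (ℂ × H), v.fst = WithLp.fstL 2 ℂ ℂ H v := fun _ => rfl
  dsimp only at hb
  rw [hlin _ hFG] at hb
  simp only [hfst, map_sum, map_smul] at hb
  have hb' := congrArg conj hb
  simp only [map_sum, smul_eq_mul, map_mul, Complex.conj_conj, ← hfst] at hb'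
  exact ((Complex.conj_conj _).symm.trans hb'.symm)

/-! ### Multipliers of the Drury-Arveson space -/

lemma mem_daMultipliers_iff (φ : UnitBall d → ℂ) :
    φ ∈ daMultipliers d ↔ ∃ C, 0 ≤ C ∧ IsMultiplierBound kvec φ C := by
  constructor
  · intro h
    refine exists_isMultiplierBound fun v => ?_
    obtain ⟨w, hw⟩ :=
      (mem_druryArveson_iff _).1 (h _ ((mem_druryArveson_iff _).2 ⟨v, fun z => rfl⟩))
    exact ⟨w, hw⟩
  · rintro ⟨C, hC, h⟩ u hu
    obtain ⟨v, hv⟩ := (mem_druryArveson_iff _).1 hu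
    obtain ⟨w, -, hw⟩ := h.exists_mul hC v
    refine (mem_druryArveson_iff _).2 ⟨w, fun z => ?_⟩
    rw [hw, hv, Pi.mul_apply]

lemma isMultiplierBound_inner (a : EuclideanSpace ℂ (Fin d)) (ha : ‖a‖ ≤ 1) :
    IsMultiplierBound kvec (fun z : UnitBall d => ⟪a, z.1⟫_ℂ) 1 := by
  rw [isMultiplierBound_iff_posSemidef _ _ zero_le_one]
  have h1 := (posSemidef_gram_sub_gram_apply (innerSL ℂ a) zero_le_one (fun v => by
    rw [innerSL_apply_apply]
    exact (norm_inner_le_norm _ _).trans (mul_le_mul_of_nonneg_right ha (norm_nonneg _)))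
    (fun z : UnitBall d => z.1)).transpose
  have h2 := (h1.hadamard (posSemidef_gram (kvec (d := d)))).add
    (posSemidef_gram fun _ : UnitBall d => (1 : ℂ))
  convert! h2 using 1
  ext z w
  have hk := one_sub_inner_mul_inner_kvec z w
  simp only [Matrix.of_apply, Matrix.add_apply, Matrix.hadamard_apply, Matrix.sub_apply,
    Matrix.gram_apply, Matrix.transpose_apply, innerSL_apply_apply, Complex.ofReal_one, one_smul]
  rw [RCLike.inner_apply ⟪a, w.1⟫_ℂ, RCLike.inner_apply (1 : ℂ), map_one]
  linear_combination hk

lemma coord_mem_daMultipliers (i : Fin d) : (fun z : UnitBall d => z.1 i) ∈ daMultipliers d := by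
  refine (mem_daMultipliers_iff _).2 ⟨1, zero_le_one, ?_⟩
  have h := isMultiplierBound_inner (EuclideanSpace.single i (1 : ℂ)) (by simp)
  simpa [EuclideanSpace.inner_single_left] using h

lemma inv_sub_inner_mem_daMultipliers (a : EuclideanSpace ℂ (Fin d)) (ha : ‖a‖ ≤ 1) (μ : ℂ)
    (hμ : 1 < ‖μ‖) : (fun z : UnitBall d => (μ - ⟪a, z.1⟫_ℂ)⁻¹) ∈ daMultipliers d := by
  refine (mem_daMultipliers_iff _).2 ⟨_, inv_nonneg.2 (sub_nonneg.2 hμ.le),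
    (isMultiplierBound_inner a ha).resolvent hμ fun z h => ?_⟩
  have h1 : ‖⟪a, z.1⟫_ℂ‖ ≤ 1 := (norm_inner_le_norm _ _).trans
    (mul_le_one₀ ha (norm_nonneg _) (mem_ball_zero_iff.1 z.2).le)
  rw [← sub_eq_zero.1 h] at h1
  linarith

lemma const_mem_daMultipliers (t : ℂ) : (fun _ : UnitBall d => t) ∈ daMultipliers d :=
  (daMultipliers d).algebraMap_mem t

/-- The Gleason problem in the multiplier algebra: up to the nonvanishing factor `1 - ⟨z, p⟩`, a
multiplier minus its value at `p` is a combination of the coordinates minus those of `p`.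
With `s² = 1 - |p|²`, the kernel `s² ⟨z - p, w - p⟩ + ⟨z - p, p⟩ ⟨p, w - p⟩` equals
`(1 - ⟨z, p⟩) (1 - ⟨p, w⟩) - s² (1 - ⟨z, w⟩)`, so the factorization theorem applies to the row of
functions `s (zᵢ - pᵢ)` and `⟨z - p, p⟩`. -/
theorem exists_gleason (ψ : UnitBall d → ℂ) (hψ : ψ ∈ daMultipliers d) (p : UnitBall d) :
    ∃ θ : Fin d → UnitBall d → ℂ, (∀ i, θ i ∈ daMultipliers d) ∧
      ∀ z, (1 - ⟪p.1, z.1⟫_ℂ) * (ψ z - ψ p) = ∑ i, (z.1 i - p.1 i) * θ i z := by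
  obtain ⟨C, hC, hχ⟩ := (mem_daMultipliers_iff _).1
    ((daMultipliers d).sub_mem hψ (const_mem_daMultipliers (ψ p)))
  obtain ⟨T, hT, hTκ⟩ := exists_clm_of_linearCombination_le _ _ hC hχ
  have hp1 : 0 ≤ 1 - ‖p.1‖ ^ 2 := by
    have := mem_ball_zero_iff.1 p.2
    nlinarith [norm_nonneg p.1]
  have hpp : ⟪p.1, p.1⟫_ℂ = ((‖p.1‖ ^ 2 : ℝ) : ℂ) := by
    rw [inner_self_eq_norm_sq_to_K]; simp
  set s : ℂ := ((√(1 - ‖p.1‖ ^ 2) : ℝ) : ℂ) with hs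
  have hss : s * s = 1 - ⟪p.1, p.1⟫_ℂ := by
    rw [hs, ← Complex.ofReal_mul, Real.mul_self_sqrt hp1, hpp]
    push_cast
    rfl
  have hsconj : conj s = s := Complex.conj_ofReal _
  let a : Option (Fin d) → UnitBall d → ℂ := fun j z =>
    j.elim (C * ⟪p.1, z.1 - p.1⟫_ℂ) fun i => C * s * (z.1 i - p.1 i)
  -- The vectors `conj (1 - ⟨z, p⟩) K_z - s² K_p` are the projections of `conj (1 - ⟨z, p⟩) K_z` to
  -- the orthogonal complement of `K_p`, and the adjoint multiplication operator vanishes at `K_p`.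
  let x := fun z : UnitBall d => conj (1 - ⟪p.1, z.1⟫_ℂ) • kvec z - (1 - ⟪p.1, p.1⟫_ℂ) • kvec p
  have hx : ∀ z, T (x z) = conj (1 - ⟪p.1, z.1⟫_ℂ) • conj (ψ z - ψ p) • kvec z := by
    intro z
    simp only [x, map_sub T, map_smul, hTκ]
    simp
  have hPSD := (posSemidef_gram_sub_gram_apply T hC hT x).submatrix
    fun z : (Set.univ : Set (UnitBall d)) => z.1
  obtain ⟨φ, hφ, hb⟩ := exists_multiplier_factorization Set.univ a
    (fun z => (1 - ⟪p.1, z.1⟫_ℂ) * (ψ z - ψ p)) (by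
      convert! hPSD using 1
      ext ⟨z, -⟩ ⟨w, -⟩
      simp only [Matrix.of_apply, Matrix.submatrix_apply, Matrix.sub_apply, Matrix.gram_apply, hx,
        Fintype.sum_option]
      have h1 := one_sub_inner_mul_inner_kvec z w
      have h2 := one_sub_inner_mul_inner_kvec z p
      have h3 := one_sub_inner_mul_inner_kvec p w
      have h4 := one_sub_inner_mul_inner_kvec p p
      have h5 : ∑ i, a (some i) z * conj (a (some i) w) =
          C * C * (s * s) * ⟪w.1 - p.1, z.1 - p.1⟫_ℂ := by
        rw [← sum_mul_conj_eq_inner, Finset.mul_sum]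
        refine Finset.sum_congr rfl fun i _ => ?_
        simp only [a, Option.elim, map_mul, Complex.conj_ofReal, hsconj, PiLp.sub_apply]
        ring
      have h6 : conj ⟪p.1, w.1⟫_ℂ = ⟪w.1, p.1⟫_ℂ := inner_conj_symm _ _
      have h7 : conj ⟪p.1, p.1⟫_ℂ = ⟪p.1, p.1⟫_ℂ := inner_conj_symm _ _
      rw [h5, hss]
      simp only [a, Option.elim, x, inner_sub_left, inner_sub_right, inner_smul_left,
        inner_smul_right, map_mul, map_sub, map_one, Complex.conj_conj, Complex.conj_ofReal, h6, h7]
      linear_combination (C : ℂ) ^ 2 * (1 - ⟪p.1, p.1⟫_ℂ) * (h2 + h3 - h1 - h4))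
  have hmem : ∀ j, φ j ∈ daMultipliers d := fun j =>
    (mem_daMultipliers_iff _).2 ⟨1, zero_le_one, hφ j⟩
  refine ⟨fun i z => C * s * φ (some i) z + C * conj (p.1 i) * φ none z, fun i => ?_, fun z => ?_⟩
  · exact (daMultipliers d).add_mem
      ((daMultipliers d).mul_mem (const_mem_daMultipliers _) (hmem _))
      ((daMultipliers d).mul_mem (const_mem_daMultipliers _) (hmem _))
  · rw [hb z (Set.mem_univ z), Fintype.sum_option]
    simp only [a, Option.elim]
    rw [← sum_mul_conj_eq_inner, Finset.mul_sum, Finset.sum_mul, ← Finset.sum_add_distrib]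
    refine Finset.sum_congr rfl fun i _ => ?_
    rw [PiLp.sub_apply]
    ring

/-! ### Holomorphy along holomorphic curves -/

/-- A holomorphic function on the disc with values in a normed space. -/
def IsHolomorphic {E : Type*} [NormedAddCommGroup E] [NormedSpace ℂ E] (φ : 𝔻 → E) : Prop :=
  ∃ F : ℂ → E, (∀ z : 𝔻, F z = φ z) ∧ DifferentiableOn ℂ F (Metric.ball 0 1)

lemma norm_kvec_sq (z : UnitBall d) : ‖kvec z‖ ^ 2 = (1 - ‖z.1‖ ^ 2)⁻¹ := by
  have h := one_sub_inner_mul_inner_kvec z z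
  rw [inner_self_eq_norm_sq_to_K, inner_self_eq_norm_sq_to_K] at h
  refine eq_inv_of_mul_eq_one_right (Complex.ofReal_injective ?_)
  push_cast
  exact h

open Filter Topology in
/-- A function in `H²_d` is a locally uniform limit of polynomials on the ball, hence holomorphic
along holomorphic curves. -/
lemma isHolomorphic_comp {h : UnitBall d → ℂ} (hh : h ∈ druryArveson d) {f : 𝔻 → UnitBall d}
    (hf : IsHolomorphic fun z => (f z).1) : IsHolomorphic fun z => h (f z) := by
  classical
  obtain ⟨v, hv⟩ := (mem_druryArveson_iff h).1 hh
  obtain ⟨F, hF', hFd⟩ := hf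
  have hF : ∀ z : 𝔻, F z = (f z).1 := hF'
  let P : Finset (Fin d → ℕ) → ℂ → ℂ := fun s z =>
    ∑ α ∈ s, v α / (√(weight α) : ℝ) * ∏ i, F z i ^ α i
  let Q : ℂ → ℂ := fun z => if hz : ‖z‖ < 1 then h (f (Complex.UnitDisc.mk z hz)) else 0
  have hPQ : TendstoLocallyUniformlyOn P Q atTop (Metric.ball 0 1) := by
    let vs : Finset (Fin d → ℕ) → lp (fun _ : Fin d → ℕ => ℂ) 2 := fun s =>
      ∑ α ∈ s, lp.single 2 α (v α)
    have hvs : Tendsto (fun s => ‖v - vs s‖) atTop (𝓝 0) := by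
      have := lp.hasSum_single (p := 2) (by simp) v
      have h1 : Tendsto vs atTop (𝓝 v) := this
      simpa using ((tendsto_const_nhds (x := v)).sub h1).norm
    have hdiff : ∀ s (z : 𝔻), Q z - P s z = ⟪kvec (f z), v - vs s⟫_ℂ := by
      intro s z
      have hQ : Q z = ⟪kvec (f z), v⟫_ℂ := by simp [Q, z.norm_lt_one, hv]
      rw [inner_sub_right, hQ, inner_sum]
      congr 1
      refine Finset.sum_congr rfl fun α _ => ?_
      rw [lp.inner_single_right, RCLike.inner_apply, kvec_apply, map_div₀, Complex.conj_conj,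
        Complex.conj_ofReal, monomial, hF]
      ring
    rw [Metric.tendstoLocallyUniformlyOn_iff]
    intro ε hε z hz
    obtain ⟨M, hM⟩ : ∃ M, ∀ᶠ y in 𝓝[Metric.ball 0 1] z, (1 - ‖F y‖ ^ 2)⁻¹ < M := by
      have hz' : 1 - ‖F z‖ ^ 2 ≠ 0 := by
        have h1 := hF (Complex.UnitDisc.mk z (mem_ball_zero_iff.1 hz))
        have h2 := mem_ball_zero_iff.1 (f (Complex.UnitDisc.mk z (mem_ball_zero_iff.1 hz))).2
        rw [← h1, Complex.UnitDisc.coe_mk] at h2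
        nlinarith [norm_nonneg (F z)]
      have hc : ContinuousWithinAt (fun y => (1 - ‖F y‖ ^ 2)⁻¹) (Metric.ball 0 1) z :=
        (continuousWithinAt_const.sub ((hFd.continuousOn z hz).norm.pow 2)).inv₀ hz'
      exact ⟨_, hc.tendsto.eventually (gt_mem_nhds (lt_add_one _))⟩
    refine ⟨{y | (1 - ‖F y‖ ^ 2)⁻¹ < M} ∩ Metric.ball 0 1,
      Filter.inter_mem hM self_mem_nhdsWithin, ?_⟩
    have hsmall : ∀ᶠ s in atTop, √M * ‖v - vs s‖ < ε := by
      have := (hvs.const_mul (√M))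
      rw [mul_zero] at this
      exact this.eventually (gt_mem_nhds hε)
    filter_upwards [hsmall] with s hs y hy
    obtain ⟨w, rfl⟩ : ∃ w : 𝔻, (w : ℂ) = y :=
      ⟨Complex.UnitDisc.mk y (mem_ball_zero_iff.1 hy.2), rfl⟩
    rw [dist_eq_norm, hdiff]
    refine (norm_inner_le_norm _ _).trans_lt (lt_of_le_of_lt ?_ hs)
    refine mul_le_mul_of_nonneg_right (Real.le_sqrt_of_sq_le ?_) (norm_nonneg _)
    rw [norm_kvec_sq, ← hF]
    exact hy.1.le
  refine ⟨Q, fun z => by simp [Q, z.norm_lt_one], ?_⟩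
  refine hPQ.differentiableOn (Eventually.of_forall fun s => ?_) Metric.isOpen_ball
  refine DifferentiableOn.fun_sum fun α _ => (differentiableOn_const _).mul ?_
  refine DifferentiableOn.fun_finsetProd fun i _ => DifferentiableOn.fun_pow ?_ _
  exact (differentiableOn_euclidean.1 hFd) i

lemma one_mem_druryArveson : (1 : UnitBall d → ℂ) ∈ druryArveson d := by
  refine (mem_druryArveson_iff _).2 ⟨kvec ⟨0, by simp⟩, fun z => ?_⟩
  rw [inner_kvec]
  simp [kernelFun]

lemma isHolomorphic_comp_of_mem_daMultipliers {ψ : UnitBall d → ℂ} (hψ : ψ ∈ daMultipliers d)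
    {f : 𝔻 → UnitBall d} (hf : IsHolomorphic fun z => (f z).1) :
    IsHolomorphic fun z => ψ (f z) := by
  have h := hψ 1 one_mem_druryArveson
  rw [mul_one] at h
  exact isHolomorphic_comp h hf

/-! ### Comparison of multiplier bounds for two kernels -/

section Comparison

variable {X H H' : Type*} [NormedAddCommGroup H] [InnerProductSpace ℂ H]
  [NormedAddCommGroup H'] [InnerProductSpace ℂ H']

/-- The bounded operators that have all kernel vectors as eigenvectors. Up to their behaviour on the
orthogonal complement of the kernel vectors, these are the adjoints of the multiplication
operators. -/
def multiplierAdjoints (κ : X → H) : Submodule ℂ (H →L[ℂ] H) :=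
  ⨅ x, (Submodule.span ℂ {κ x}).comap (ContinuousLinearMap.apply ℂ H (κ x)).toLinearMap

lemma isClosed_multiplierAdjoints (κ : X → H) :
    IsClosed (multiplierAdjoints κ : Set (H →L[ℂ] H)) := by
  rw [multiplierAdjoints, Submodule.coe_iInf]
  refine isClosed_iInter fun x => ?_
  exact (Submodule.closed_of_finiteDimensional (Submodule.span ℂ {κ x})).preimage
    (ContinuousLinearMap.apply ℂ H (κ x)).continuous

/-- If all multipliers for `κ` are multipliers for `κ'`, then the multiplier bounds for `κ'` are
dominated by those for `κ`: the uniform boundedness principle applies to the Banach space of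
adjoint multiplication operators for `κ`. -/
lemma exists_isMultiplierBound_mul [CompleteSpace H] (κ : X → H) (κ' : X → H')
    (hκ : ∀ x, κ x ≠ 0)
    (h : ∀ φ : X → ℂ, (∃ C, 0 ≤ C ∧ IsMultiplierBound κ φ C) →
      ∃ C, 0 ≤ C ∧ IsMultiplierBound κ' φ C) :
    ∃ B, 0 < B ∧ ∀ φ C, 0 ≤ C → IsMultiplierBound κ φ C → IsMultiplierBound κ' φ (B * C) := by
  have : CompleteSpace (multiplierAdjoints κ) :=
    (isClosed_multiplierAdjoints κ).completeSpace_coe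
  have hk : ∀ x, ⟪κ x, κ x⟫_ℂ ≠ 0 := fun x => inner_self_ne_zero.2 (hκ x)
  -- The eigenvalue at `κ x`, as a continuous linear functional of the operator.
  let eig : X → multiplierAdjoints κ →L[ℂ] ℂ := fun x => (⟪κ x, κ x⟫_ℂ)⁻¹ •
    ((innerSL ℂ (κ x)).comp (ContinuousLinearMap.apply ℂ H (κ x))).comp
      (multiplierAdjoints κ).subtypeL
  have heig_of : ∀ (T : multiplierAdjoints κ) x t, T.1 (κ x) = t • κ x → eig x T = t := by
    intro T x t ht
    change (⟪κ x, κ x⟫_ℂ)⁻¹ * ⟪κ x, T.1 (κ x)⟫_ℂ = t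
    rw [ht, inner_smul_right, mul_comm, mul_assoc, mul_inv_cancel₀ (hk x), mul_one]
  have heig : ∀ (T : multiplierAdjoints κ) x, T.1 (κ x) = eig x T • κ x := by
    intro T x
    obtain ⟨t, ht⟩ := Submodule.mem_span_singleton.1 ((Submodule.mem_iInf _).1 T.2 x)
    have ht' : T.1 (κ x) = t • κ x := ht.symm
    rw [heig_of T x t ht', ht']
  let I := {c : X →₀ ℂ // ‖Finsupp.linearCombination ℂ κ' c‖ ≤ 1}
  let g : I → multiplierAdjoints κ →L[ℂ] H' := fun c =>
    ∑ x ∈ c.1.support, c.1 x • (eig x).smulRight (κ' x)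
  have hg : ∀ (c : I) T, g c T =
      Finsupp.linearCombination ℂ (fun x => conj (conj (eig x T)) • κ' x) c.1 := by
    intro c T
    simp [g, Finsupp.linearCombination_apply, Finsupp.sum, sum_apply]
  obtain ⟨B, hB⟩ := banach_steinhaus (g := g) (by
    intro T
    have hT : IsMultiplierBound κ (fun x => conj (eig x T)) ‖T.1‖ := by
      intro c
      have h1 := T.1.le_opNorm (Finsupp.linearCombination ℂ κ c)
      rw [← linearCombination_clm_apply] at h1
      simpa only [heig, Complex.conj_conj] using h1
    obtain ⟨C, hC, hbd⟩ := h _ ⟨‖T.1‖, norm_nonneg T.1, hT⟩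
    refine ⟨C, fun c => ?_⟩
    rw [hg]
    exact (hbd c.1).trans (mul_le_of_le_one_right hC c.2))
  refine ⟨|B| + 1, by positivity, fun φ C hC hφ => isMultiplierBound_of_norm_le_one fun c hc => ?_⟩
  obtain ⟨T, hT, hTκ⟩ := exists_clm_of_linearCombination_le κ _ hC hφ
  let T' : multiplierAdjoints κ := ⟨T, (Submodule.mem_iInf _).2 fun x =>
    Submodule.mem_span_singleton.2 ⟨conj (φ x), (hTκ x).symm⟩⟩
  have h1 := (g ⟨c, hc⟩).le_of_opNorm_le (hB ⟨c, hc⟩) T'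
  rw [hg] at h1
  have h2 : ∀ x, eig x T' = conj (φ x) := fun x => heig_of T' x _ (hTκ x)
  simp only [h2, Complex.conj_conj] at h1
  refine h1.trans ?_
  have h3 : ‖T'‖ ≤ C := T.opNorm_le_bound hC hT
  calc B * ‖T'‖ ≤ (|B| + 1) * ‖T'‖ :=
        mul_le_mul_of_nonneg_right ((le_abs_self B).trans (by linarith)) (norm_nonneg _)
    _ ≤ (|B| + 1) * C := mul_le_mul_of_nonneg_left h3 (by positivity)

end Comparison

/-! ### The multiplier algebra and its norm on a subset of the ball -/

/-- The Pick property: the restrictions of multipliers of `H²_d` to `V` are all the functions with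
a multiplier bound on `V`. -/
lemma mem_varietyAlgebra_iff (V : Set (UnitBall d)) (φ : V → ℂ) :
    φ ∈ varietyAlgebra V ↔ ∃ C, 0 ≤ C ∧ IsMultiplierBound (fun v : V => kvec v.1) φ C := by
  classical
  constructor
  · rintro ⟨ψ, hψ, rfl⟩
    obtain ⟨C, hC, h⟩ := (mem_daMultipliers_iff ψ).1 hψ
    exact ⟨C, hC, h.comp Subtype.val⟩
  · rintro ⟨C, hC, h⟩
    let b : UnitBall d → ℂ := fun z => if hz : z ∈ V then φ ⟨z, hz⟩ else 0
    have hb : ∀ v : V, b v = φ v := fun v => by simp [b, v.2]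
    obtain ⟨θ, hθ, hbθ⟩ := exists_multiplier_factorization V (fun (_ : Unit) _ => (C : ℂ)) b (by
      convert! (isMultiplierBound_iff_posSemidef _ _ hC).1 h using 1
      ext z w
      simp [hb, sq])
    refine ⟨fun z => C * θ () z, ?_, ?_⟩
    · exact (daMultipliers d).mul_mem (const_mem_daMultipliers _)
        ((mem_daMultipliers_iff _).2 ⟨1, zero_le_one, hθ ()⟩)
    · funext v
      have := hbθ v v.2
      rw [hb] at this
      change C * θ () v.1 = φ v
      rw [this]
      simp

/-- The function on the ball represented by a vector of the model. -/
def evalKernel (d : ℕ) : lp (fun _ : Fin d → ℕ => ℂ) 2 →ₗ[ℂ] (UnitBall d → ℂ) where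
  toFun v z := ⟪kvec z, v⟫_ℂ
  map_add' u v := by ext z; exact inner_add_right _ _ _
  map_smul' t v := by ext z; exact inner_smul_right _ _ _

lemma map_evalKernel_span (V : Set (UnitBall d)) :
    (Submodule.span ℂ (Set.range fun v : V => kvec v.1)).map (evalKernel d) =
      Submodule.span ℂ (kernelFun '' V) := by
  rw [Submodule.map_span, ← Set.range_comp]
  congr 1
  ext h
  constructor
  · rintro ⟨v, rfl⟩
    exact ⟨v.1, v.2, funext fun z => (inner_kvec z v.1).symm⟩
  · rintro ⟨v, hv, rfl⟩
    exact ⟨⟨v, hv⟩, funext fun z => inner_kvec z v⟩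

lemma kernelSpan_mono (V : Set (UnitBall d)) :
    kernelSpan (fun v : V => kvec v.1) ≤ kernelSpan (kvec (d := d)) := by
  refine Submodule.topologicalClosure_mono (Submodule.span_mono ?_)
  rintro _ ⟨v, rfl⟩
  exact ⟨v.1, rfl⟩

lemma mem_hilbertSpan_iff (V : Set (UnitBall d)) (h : UnitBall d → ℂ) :
    h ∈ hilbertSpan V ↔ ∃ v ∈ kernelSpan (fun v : V => kvec v.1), evalKernel d v = h := by
  constructor
  · rintro ⟨hh, happ⟩
    obtain ⟨v₀, hv₀⟩ := (mem_druryArveson_iff h).1 hh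
    obtain ⟨v, hv, -, hvv₀⟩ := exists_mem_kernelSpan (kvec (d := d)) v₀
    have hvh : evalKernel d v = h := funext fun z => (hvv₀ z).trans (hv₀ z)
    refine ⟨v, ?_, hvh⟩
    refine Metric.mem_closure_iff.2 fun ε hε => ?_
    obtain ⟨p, hp, hpε⟩ := happ ε hε
    rw [← map_evalKernel_span] at hp
    obtain ⟨q, hq, rfl⟩ := hp
    refine ⟨q, hq, ?_⟩
    rw [dist_eq_norm, ← daNorm_eq (h := h - evalKernel d q) (Submodule.sub_mem _ hv
      (kernelSpan_mono V (Submodule.le_topologicalClosure _ hq))) (fun z => ?_)]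
    · exact hpε
    · rw [← hvh, inner_sub_right]; rfl
  · rintro ⟨v, hv, rfl⟩
    refine ⟨(mem_druryArveson_iff _).2 ⟨v, fun z => rfl⟩, fun ε hε => ?_⟩
    obtain ⟨q, hq, hqε⟩ := Metric.mem_closure_iff.1 hv ε hε
    refine ⟨evalKernel d q, by rw [← map_evalKernel_span]; exact ⟨q, hq, rfl⟩, ?_⟩
    rw [← map_sub, daNorm_eq (h := evalKernel d (v - q)) (v := v - q)
      (kernelSpan_mono V (Submodule.sub_mem _ hv (Submodule.le_topologicalClosure _ hq)))
      fun z => rfl, ← dist_eq_norm]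
    exact hqε

lemma mem_varietySpace_iff (V : Set (UnitBall d)) (u : V → ℂ) :
    u ∈ varietySpace V ↔
      ∃ v ∈ kernelSpan (fun v : V => kvec v.1), ∀ x : V, ⟪kvec x.1, v⟫_ℂ = u x := by
  constructor
  · rintro ⟨h, hh, hu⟩
    obtain ⟨v, hv, rfl⟩ := (mem_hilbertSpan_iff V h).1 hh
    exact ⟨v, hv, hu⟩
  · rintro ⟨v, hv, hu⟩
    exact ⟨_, (mem_hilbertSpan_iff V _).2 ⟨v, hv, rfl⟩, hu⟩

lemma varietySpaceNorm_eq (V : Set (UnitBall d)) {u : V → ℂ}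
    {v : lp (fun _ : Fin d → ℕ => ℂ) 2} (hv : v ∈ kernelSpan fun v : V => kvec v.1)
    (hu : ∀ x : V, ⟪kvec x.1, v⟫_ℂ = u x) : varietySpaceNorm V u = ‖v‖ := by
  have hN : ∀ w ∈ kernelSpan (fun v : V => kvec v.1), daNorm (evalKernel d w) = ‖w‖ :=
    fun w hw => daNorm_eq (kernelSpan_mono V hw) fun z => rfl
  have h1 : {r | ∃ h ∈ hilbertSpan V, (∀ v : V, h v = u v) ∧ r = daNorm h} = {‖v‖} := by
    ext r
    constructor
    · rintro ⟨h, hh, hhu, rfl⟩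
      obtain ⟨w, hw, rfl⟩ := (mem_hilbertSpan_iff V h).1 hh
      rw [hN w hw, eq_of_mem_kernelSpan hw hv fun x => (hhu x).trans (hu x).symm]
      rfl
    · rintro rfl
      exact ⟨_, (mem_hilbertSpan_iff V _).2 ⟨v, hv, rfl⟩, hu, (hN v hv).symm⟩
  rw [varietySpaceNorm, h1, csInf_singleton]

/-- On `M_V` the multiplier norm is the least multiplier bound. -/
lemma varietyAlgebraNorm_eq (V : Set (UnitBall d)) {φ : V → ℂ} (hφ : φ ∈ varietyAlgebra V) :
    varietyAlgebraNorm V φ =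
      sInf {C | 0 ≤ C ∧ IsMultiplierBound (fun v : V => kvec v.1) φ C} := by
  have hmul : ∀ C, 0 ≤ C → IsMultiplierBound (fun v : V => kvec v.1) φ C →
      ∀ v, ∃ w ∈ kernelSpan (fun v : V => kvec v.1), ‖w‖ ≤ C * ‖v‖ ∧
        ∀ x : V, ⟪kvec x.1, w⟫_ℂ = φ x * ⟪kvec x.1, v⟫_ℂ := by
    intro C hC h v
    obtain ⟨w, hw, hwφ⟩ := h.exists_mul hC v
    obtain ⟨w', hw', hle, hww'⟩ := exists_mem_kernelSpan (fun v : V => kvec v.1) w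
    exact ⟨w', hw', hle.trans hw, fun x => (hww' x).trans (hwφ x)⟩
  unfold varietyAlgebraNorm
  congr 1
  ext C
  refine and_congr_right fun hC => ⟨fun h => isMultiplierBound_of_span fun v hv => ?_,
    fun h u hu => ?_⟩
  · obtain ⟨C', hC', h'⟩ := (mem_varietyAlgebra_iff V φ).1 hφ
    obtain ⟨w, hw, -, hwφ⟩ := hmul C' hC' h' v
    have hvs : v ∈ kernelSpan fun v : V => kvec v.1 := Submodule.le_topologicalClosure _ hv
    have h1 := h (fun x => ⟪kvec x.1, v⟫_ℂ) ((mem_varietySpace_iff V _).2 ⟨v, hvs, fun x => rfl⟩)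
    rw [varietySpaceNorm_eq V hvs fun x => rfl,
      varietySpaceNorm_eq V (u := φ * fun x : V => ⟪kvec x.1, v⟫_ℂ) hw hwφ] at h1
    exact ⟨w, h1, hwφ⟩
  · obtain ⟨v, hv, hvu⟩ := (mem_varietySpace_iff V u).1 hu
    obtain ⟨w, hw, hle, hwφ⟩ := hmul C hC h v
    rw [varietySpaceNorm_eq V hv hvu, varietySpaceNorm_eq V hw fun x => by
      rw [hwφ, hvu, Pi.mul_apply]]
    exact hle

/-! ### The algebra of an embedded disc -/

lemma rangeSplitting_rangeFactorization {f : 𝔻 → UnitBall d} (hf : Function.Injective f) (z : 𝔻) :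
    Set.rangeSplitting f ⟨f z, z, rfl⟩ = z :=
  hf (Set.apply_rangeSplitting f _)

lemma isMultiplierBound_rangeSplitting_iff {f : 𝔻 → UnitBall d} (hf : Function.Injective f)
    (φ : 𝔻 → ℂ) (C : ℝ) :
    IsMultiplierBound (fun v : Set.range f => kvec v.1) (φ ∘ Set.rangeSplitting f) C ↔
      IsMultiplierBound (fun z => kvec (f z)) φ C := by
  constructor
  · intro h
    have h1 := h.comp fun z : 𝔻 => (⟨f z, z, rfl⟩ : Set.range f)
    simpa only [Function.comp_apply, rangeSplitting_rangeFactorization hf] using h1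
  · intro h
    have h1 := h.comp (Set.rangeSplitting f)
    simp only [Set.apply_rangeSplitting] at h1
    exact h1

lemma mem_discAlgebra_iff_exists_bound {f : 𝔻 → UnitBall d} (hf : Function.Injective f)
    (φ : 𝔻 → ℂ) :
    φ ∈ discAlgebra f ↔ ∃ C, 0 ≤ C ∧ IsMultiplierBound (fun z => kvec (f z)) φ C := by
  simp only [← isMultiplierBound_rangeSplitting_iff hf]
  exact mem_varietyAlgebra_iff _ _

lemma discAlgebraNorm_eq {f : 𝔻 → UnitBall d} (hf : Function.Injective f) {φ : 𝔻 → ℂ}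
    (hφ : φ ∈ discAlgebra f) : discAlgebraNorm f φ =
      sInf {C | 0 ≤ C ∧ IsMultiplierBound (fun z => kvec (f z)) φ C} := by
  simp only [← isMultiplierBound_rangeSplitting_iff hf]
  exact varietyAlgebraNorm_eq _ hφ

lemma mem_discAlgebra_iff {f : 𝔻 → UnitBall d} (hf : Function.Injective f) (φ : 𝔻 → ℂ) :
    φ ∈ discAlgebra f ↔ ∃ ψ ∈ daMultipliers d, ∀ z, ψ (f z) = φ z := by
  constructor
  · rintro ⟨ψ, hψ, h⟩
    refine ⟨ψ, hψ, fun z => ?_⟩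
    have := congrFun h ⟨f z, z, rfl⟩
    exact this.trans (congrArg φ (rangeSplitting_rangeFactorization hf z))
  · rintro ⟨ψ, hψ, h⟩
    refine ⟨ψ, hψ, funext fun v => ?_⟩
    change ψ v = φ (Set.rangeSplitting f v)
    rw [← h, Set.apply_rangeSplitting f]

lemma kvec_ne_zero (z : UnitBall d) : kvec z ≠ 0 := by
  intro h
  have := one_sub_inner_mul_inner_kvec z z
  simp [h] at this

/-- Inclusion of algebras of embedded discs is bounded. -/
lemma exists_discAlgebraNorm_le {e : ℕ} {f : 𝔻 → UnitBall d} {g : 𝔻 → UnitBall e}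
    (hf : Function.Injective f) (hg : Function.Injective g) (h : discAlgebra f ≤ discAlgebra g) :
    ∃ B, 0 < B ∧ ∀ φ ∈ discAlgebra f, discAlgebraNorm g φ ≤ B * discAlgebraNorm f φ := by
  obtain ⟨B, hB, hBφ⟩ := exists_isMultiplierBound_mul (fun z => kvec (f z)) (fun z => kvec (g z))
    (fun z => kvec_ne_zero _) fun φ hφ =>
      (mem_discAlgebra_iff_exists_bound hg φ).1 (h ((mem_discAlgebra_iff_exists_bound hf φ).2 hφ))
  refine ⟨B, hB, fun φ hφ => ?_⟩
  rw [discAlgebraNorm_eq hf hφ, discAlgebraNorm_eq hg (h hφ), ← div_le_iff₀' hB]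
  refine le_csInf ((mem_discAlgebra_iff_exists_bound hf φ).1 hφ) ?_
  rintro C ⟨hC, hCφ⟩
  rw [div_le_iff₀' hB]
  exact csInf_le ⟨0, fun _ h => h.1⟩ ⟨by positivity, hBφ φ C hC hCφ⟩

/-! ### Characters of the multiplier algebra -/

section Character

variable (χ : daMultipliers d →ₐ[ℂ] ℂ)

/-- The coordinate functions, as elements of the multiplier algebra. -/
def coord (i : Fin d) : daMultipliers d := ⟨fun z => z.1 i, coord_mem_daMultipliers i⟩

/-- The values of a character at the coordinate functions. -/
def charPoint : EuclideanSpace ℂ (Fin d) := WithLp.toLp 2 fun i => χ (coord i)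

lemma charPoint_apply (i : Fin d) : charPoint χ i = χ (coord i) := rfl

/-- The linear functional `z ↦ ⟨z, a⟩`, as an element of the multiplier algebra. -/
def linearForm (a : EuclideanSpace ℂ (Fin d)) : daMultipliers d := ∑ i, conj (a i) • coord i

lemma linearForm_apply (a : EuclideanSpace ℂ (Fin d)) (z : UnitBall d) :
    (linearForm a).1 z = ⟪a, z.1⟫_ℂ := by
  have h : (linearForm a).1 = ∑ i, conj (a i) • (coord i).1 := by
    simp [linearForm]
  rw [h, Finset.sum_apply, ← sum_mul_conj_eq_inner]
  exact Finset.sum_congr rfl fun i _ => mul_comm _ _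

lemma map_linearForm (a : EuclideanSpace ℂ (Fin d)) : χ (linearForm a) = ⟪a, charPoint χ⟫_ℂ := by
  rw [linearForm, map_sum, ← sum_mul_conj_eq_inner]
  refine Finset.sum_congr rfl fun i _ => ?_
  rw [map_smul, charPoint_apply, smul_eq_mul, mul_comm]

/-- The coordinates form a row contraction, so characters take them to the closed ball: otherwise
an invertible element `μ - ⟨z, a⟩` would be in the kernel. -/
lemma norm_charPoint_le_one : ‖charPoint χ‖ ≤ 1 := by
  by_contra! hlt
  set r := ‖charPoint χ‖ with hr
  have hr0 : (r : ℂ) ≠ 0 := Complex.ofReal_ne_zero.2 (by linarith)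
  set a : EuclideanSpace ℂ (Fin d) := (r : ℂ)⁻¹ • charPoint χ with ha
  have hna : ‖a‖ ≤ 1 := by
    rw [ha, norm_smul, ← hr, norm_inv, Complex.norm_real, Real.norm_of_nonneg (by linarith),
      inv_mul_cancel₀ (by linarith)]
  have hμ : 1 < ‖(r : ℂ)‖ := by rwa [Complex.norm_real, Real.norm_of_nonneg (by linarith)]
  let b : daMultipliers d := ⟨_, inv_sub_inner_mem_daMultipliers a hna r hμ⟩
  have h1 : (algebraMap ℂ (daMultipliers d) r - linearForm a) * b = 1 := by
    refine Subtype.ext (funext fun z => ?_)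
    change ((r : ℂ) - (linearForm a).1 z) * ((r : ℂ) - ⟪a, z.1⟫_ℂ)⁻¹ = 1
    rw [linearForm_apply]
    refine mul_inv_cancel₀ fun h => ?_
    have h2 : ‖⟪a, z.1⟫_ℂ‖ ≤ 1 := (norm_inner_le_norm _ _).trans
      (mul_le_one₀ hna (norm_nonneg _) (mem_ball_zero_iff.1 z.2).le)
    rw [← sub_eq_zero.1 h] at h2
    linarith
  have h2 := congrArg χ h1
  have h3 : ⟪a, charPoint χ⟫_ℂ = r := by
    rw [ha, inner_smul_left, map_inv₀, Complex.conj_ofReal, inner_self_eq_norm_sq_to_K, ← hr]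
    change (r : ℂ)⁻¹ * (r : ℂ) ^ 2 = r
    rw [sq, inv_mul_cancel_left₀ hr0]
  rw [map_mul, map_sub, AlgHom.commutes, map_linearForm, h3, map_one] at h2
  simp at h2

/-- A character that takes the coordinates to a point of the open ball is the evaluation at that
point, since the Gleason problem is solvable. -/
lemma char_eq_eval (h : ‖charPoint χ‖ < 1) (ψ : daMultipliers d) :
    χ ψ = ψ.1 ⟨charPoint χ, mem_ball_zero_iff.2 h⟩ := by
  set p : UnitBall d := ⟨charPoint χ, mem_ball_zero_iff.2 h⟩ with hp
  obtain ⟨θ, hθ, hψ⟩ := exists_gleason ψ.1 ψ.2 p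
  have h1 : (1 - linearForm p.1) * (ψ - algebraMap ℂ (daMultipliers d) (ψ.1 p)) =
      ∑ i, (coord i - algebraMap ℂ (daMultipliers d) (p.1 i)) * ⟨θ i, hθ i⟩ := by
    refine Subtype.ext (funext fun z => ?_)
    rw [AddSubmonoidClass.coe_finsetSum, Finset.sum_apply]
    refine Eq.trans ?_ (hψ z)
    change (1 - (linearForm p.1).1 z) * _ = _
    rw [linearForm_apply]
    rfl
  have h2 := congrArg χ h1
  rw [map_sum, map_mul, map_sub, map_sub, map_one, AlgHom.commutes, map_linearForm,
    Finset.sum_eq_zero fun i _ => by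
      rw [map_mul, map_sub, AlgHom.commutes]
      exact mul_eq_zero_of_left (sub_self _) _] at h2
  exact sub_eq_zero.1 ((mul_eq_zero.1 h2).resolve_left (one_sub_inner_ne_zero p p))

end Character

/-! ### Holomorphy of the inverse of an embedding map -/

lemma IsEmbeddingMap.isHolomorphic {d : ℕ} {V : Set (UnitBall d)} {f : 𝔻 → UnitBall d}
    (hf : IsEmbeddingMap V f) : IsHolomorphic fun z => (f z).1 := by
  obtain ⟨F, hF, hFd, -⟩ := hf.exists_extension
  exact ⟨F, hF, hFd⟩

open Filter Topology in
/-- An embedding map is proper, since its extension takes the unit circle to the sphere, and it is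
an immersion. Hence maps into the disc that become holomorphic after composition with it are
holomorphic. -/
lemma IsEmbeddingMap.isHolomorphicSelfMap {d : ℕ} {V : Set (UnitBall d)} {f : 𝔻 → UnitBall d}
    (hf : IsEmbeddingMap V f) {m : 𝔻 → 𝔻} (hm : IsHolomorphic fun z => (f (m z)).1) :
    IsHolomorphicSelfMap m := by
  obtain ⟨F, hF, hFd, hF', hFc, hFb⟩ := hf.exists_extension
  obtain ⟨G, hG', hGd⟩ := hm
  have hG : ∀ z : 𝔻, G z = (f (m z)).1 := hG'
  let M : ℂ → ℂ := fun z => if hz : ‖z‖ < 1 then m (Complex.UnitDisc.mk z hz) else 0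
  have hM : ∀ z : 𝔻, M z = m z := fun z => by simp [M, z.norm_lt_one]
  have hFM : ∀ z ∈ Metric.ball (0 : ℂ) 1, F (M z) = G z := by
    intro z hz
    obtain ⟨w, rfl⟩ : ∃ w : 𝔻, (w : ℂ) = z :=
      ⟨Complex.UnitDisc.mk z (mem_ball_zero_iff.1 hz), rfl⟩
    rw [hM, hF, hG]
  have hMmem : ∀ z, M z ∈ Metric.closedBall (0 : ℂ) 1 := by
    intro z
    rw [mem_closedBall_zero_iff]
    by_cases hz : ‖z‖ < 1
    · simpa [M, hz] using (Complex.UnitDisc.norm_lt_one _).le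
    · simp [M, hz]
  refine ⟨M, hM, fun z₀ hz₀ => DifferentiableAt.differentiableWithinAt ?_⟩
  have hnhds : Metric.ball (0 : ℂ) 1 ∈ 𝓝 z₀ := Metric.isOpen_ball.mem_nhds hz₀
  obtain ⟨w₀, rfl⟩ : ∃ w : 𝔻, (w : ℂ) = z₀ :=
    ⟨Complex.UnitDisc.mk z₀ (mem_ball_zero_iff.1 hz₀), rfl⟩
  have hcont : Tendsto M (𝓝 (w₀ : ℂ)) (𝓝 (m w₀ : ℂ)) := by
    refine (isCompact_closedBall (0 : ℂ) 1).tendsto_nhds_of_unique_mapClusterPt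
      (Eventually.of_forall hMmem) fun y hy hcl => ?_
    obtain ⟨U, hU, hUy⟩ := mapClusterPt_iff_ultrafilter.1 hcl
    have h1 : Tendsto (fun z => F (M z)) U (𝓝 (F y)) :=
      (hFc.continuousOn y hy).tendsto.comp
        (tendsto_nhdsWithin_iff.2 ⟨hUy, Eventually.of_forall hMmem⟩)
    have h2 : Tendsto (fun z => F (M z)) U (𝓝 (G w₀)) := by
      refine Tendsto.congr' ?_ (((hGd.differentiableAt hnhds).continuousAt.tendsto).mono_left hU)
      exact hU (mem_of_superset hnhds fun z hz => (hFM z hz).symm)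
    have h3 : F y = (f (m w₀)).1 := (tendsto_nhds_unique h1 h2).trans (hG w₀)
    have h4 : ‖y‖ ≠ 1 := fun h => by
      have h5 := (hFb y hy).2 h
      rw [h3] at h5
      exact (mem_ball_zero_iff.1 (f (m w₀)).2).ne h5
    have h5 : ‖y‖ < 1 := lt_of_le_of_ne (mem_closedBall_zero_iff.1 hy) h4
    have h6 : f (Complex.UnitDisc.mk y h5) = f (m w₀) := Subtype.ext ((hF _).symm.trans h3)
    rw [← hf.injective h6]
    rfl
  have hmem : (m w₀ : ℂ) ∈ Metric.ball (0 : ℂ) 1 := mem_ball_zero_iff.2 (m w₀).norm_lt_one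
  have hFan : AnalyticAt ℂ F (m w₀) := hFd.analyticAt (Metric.isOpen_ball.mem_nhds hmem)
  obtain ⟨i, hi⟩ : ∃ i, (deriv F (m w₀)) i ≠ 0 := by
    by_contra! hall
    exact hF' _ hmem (by ext i; exact hall i)
  have hstrict : HasStrictDerivAt (fun w => F w i) (deriv F (m w₀) i) (m w₀) :=
    (EuclideanSpace.proj i : EuclideanSpace ℂ (Fin d) →L[ℂ] ℂ).hasStrictFDerivAt
      |>.comp_hasStrictDerivAt (m w₀ : ℂ) hFan.hasStrictDerivAt
  -- Near `w₀` the map is a local inverse of a coordinate of `F`, applied to that coordinate of `G`.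
  have hinv := hstrict.eventually_left_inverse hi
  have hloc : M =ᶠ[𝓝 (w₀ : ℂ)] fun z => hstrict.localInverse _ _ _ hi (G z i) := by
    filter_upwards [hcont.eventually hinv, hnhds] with z hz hz1
    rw [← hFM z hz1]
    exact hz.symm
  refine DifferentiableAt.congr_of_eventuallyEq ?_ hloc
  have h1 : DifferentiableAt ℂ (fun z => G z i) (w₀ : ℂ) :=
    (differentiableAt_euclidean.1 (hGd.differentiableAt hnhds)) i
  have h2 : G w₀ i = F (m w₀) i := by rw [hG, hF]
  refine DifferentiableAt.comp (w₀ : ℂ) ?_ h1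
  rw [h2]
  exact (hstrict.to_localInverse hi).hasDerivAt.differentiableAt

/-! ### Homomorphisms between algebras of embedded discs -/

lemma discAlgebra_isHolomorphic {e : ℕ} {W : Set (UnitBall e)} {g : 𝔻 → UnitBall e}
    (hg : IsEmbeddingMap W g) (φ : discAlgebra g) : IsHolomorphic φ.1 := by
  obtain ⟨ψ, hψ, h⟩ := (mem_discAlgebra_iff hg.injective φ.1).1 φ.2
  rw [← funext h]
  exact isHolomorphic_comp_of_mem_daMultipliers hψ hg.isHolomorphic

/-- Composition of multipliers with an embedding map. -/
def pullback {d : ℕ} (f : 𝔻 → UnitBall d) (hf : Function.Injective f) :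
    daMultipliers d →ₐ[ℂ] discAlgebra f :=
  ((precomp f).comp (daMultipliers d).val).codRestrict (discAlgebra f) fun ψ =>
    (mem_discAlgebra_iff hf _).2 ⟨ψ.1, ψ.2, fun _ => rfl⟩

/-- Evaluation at a point of the disc, as a character. -/
def evalAt {d : ℕ} (f : 𝔻 → UnitBall d) (z : 𝔻) : discAlgebra f →ₐ[ℂ] ℂ :=
  (Pi.evalAlgHom ℂ (fun _ : 𝔻 => ℂ) z).comp (discAlgebra f).val

/-- Injective homomorphisms between algebras of embedded discs are compositions with holomorphic
maps of the disc. -/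
theorem exists_composition {d e : ℕ} {V : Set (UnitBall d)} {W : Set (UnitBall e)}
    {f : 𝔻 → UnitBall d} {g : 𝔻 → UnitBall e} (hf : IsEmbeddingMap V f) (hg : IsEmbeddingMap W g)
    (Φ : discAlgebra f →ₐ[ℂ] discAlgebra g) (hΦ : Function.Injective Φ) :
    ∃ m : 𝔻 → 𝔻, IsHolomorphicSelfMap m ∧ ∀ φ z, (Φ φ).1 z = φ.1 (m z) := by
  let χ : 𝔻 → daMultipliers d →ₐ[ℂ] ℂ := fun z =>
    ((evalAt g z).comp Φ).comp (pullback f hf.injective)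
  have hχ : ∀ z ψ, χ z ψ = (Φ (pullback f hf.injective ψ)).1 z := fun _ _ => rfl
  have hhol : IsHolomorphic fun z => charPoint (χ z) := by
    choose F hF hFd using fun i =>
      discAlgebra_isHolomorphic hg (Φ (pullback f hf.injective (coord i)))
    refine ⟨fun z => WithLp.toLp 2 fun i => F i z, fun z => ?_, differentiableOn_euclidean.2 hFd⟩
    ext i
    exact hF i z
  -- If the sphere is reached, the maximum principle makes the images of the coordinates constant.
  have hlt : ∀ z, ‖charPoint (χ z)‖ < 1 := by
    intro z₀
    refine lt_of_le_of_ne (norm_charPoint_le_one _) fun h1 => ?_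
    obtain ⟨G, hG, hGd⟩ := hhol
    have hmax : IsMaxOn (norm ∘ G) (Metric.ball 0 1) (z₀ : ℂ) := by
      intro z hz
      obtain ⟨w, rfl⟩ : ∃ w : 𝔻, (w : ℂ) = z :=
        ⟨Complex.UnitDisc.mk z (mem_ball_zero_iff.1 hz), rfl⟩
      change ‖G w‖ ≤ ‖G z₀‖
      rw [hG, hG]
      exact (norm_charPoint_le_one _).trans_eq h1.symm
    have hconst := Complex.eqOn_of_isPreconnected_of_isMaxOn_norm
      (convex_ball (0 : ℂ) 1).isPreconnected Metric.isOpen_ball hGd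
      (mem_ball_zero_iff.2 z₀.norm_lt_one) hmax
    have hc : ∀ z : 𝔻, charPoint (χ z) = charPoint (χ z₀) := fun z =>
      (hG z).symm.trans ((hconst (mem_ball_zero_iff.2 z.norm_lt_one)).trans (hG z₀))
    have hcoord : ∀ i, pullback f hf.injective (coord i) =
        algebraMap ℂ (discAlgebra f) (charPoint (χ z₀) i) := by
      intro i
      refine hΦ (Subtype.ext (funext fun z => ?_))
      rw [AlgHom.commutes, ← hχ, ← charPoint_apply, hc]
      rfl
    have hfz : (f z₀).1 = charPoint (χ z₀) := by
      ext i
      exact congrFun (congrArg Subtype.val (hcoord i)) z₀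
    have h2 := mem_ball_zero_iff.1 (f z₀).2
    rw [hfz, h1] at h2
    exact lt_irrefl _ h2
  have heval : ∀ z ψ, χ z ψ = ψ.1 ⟨charPoint (χ z), mem_ball_zero_iff.2 (hlt z)⟩ :=
    fun z ψ => char_eq_eval (χ z) (hlt z) ψ
  have hV : ∀ z, ∃ w, f w = ⟨charPoint (χ z), mem_ball_zero_iff.2 (hlt z)⟩ := by
    intro z
    obtain ⟨E, hE, hVE⟩ := hf.isVariety
    have h1 : (⟨charPoint (χ z), mem_ball_zero_iff.2 (hlt z)⟩ : UnitBall d) ∈ V := by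
      rw [hVE]
      intro ψ hψ
      refine (heval z ⟨ψ, hE hψ⟩).symm.trans ?_
      rw [hχ]
      have h0 : pullback f hf.injective ⟨ψ, hE hψ⟩ = 0 := by
        refine Subtype.ext (funext fun w => ?_)
        have hw : f w ∈ V := hf.range_eq ▸ Set.mem_range_self w
        rw [hVE] at hw
        exact hw ψ hψ
      rw [h0, map_zero]
      rfl
    rw [← hf.range_eq] at h1
    exact h1
  choose m hm using hV
  refine ⟨m, hf.isHolomorphicSelfMap ?_, fun φ z => ?_⟩
  · simpa only [hm] using hhol
  · obtain ⟨ψ, hψ, h⟩ := (mem_discAlgebra_iff hf.injective φ.1).1 φ.2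
    have hφ : φ = pullback f hf.injective ⟨ψ, hψ⟩ := Subtype.ext (funext fun w => (h w).symm)
    rw [← h, hm, hφ, ← hχ]
    exact heval z ⟨ψ, hψ⟩

lemma eq_of_forall_discAlgebra {d : ℕ} {f : 𝔻 → UnitBall d} (hf : Function.Injective f) {z w : 𝔻}
    (h : ∀ φ : discAlgebra f, φ.1 z = φ.1 w) : z = w :=
  hf <| Subtype.ext <| by ext i; exact h (pullback f hf (coord i))

end AnalyticDisc

end

theorem mainTheorem2 {d e : ℕ}
    (V : Set (AnalyticDisc.UnitBall d)) (W : Set (AnalyticDisc.UnitBall e))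
    (f : 𝔻 → AnalyticDisc.UnitBall d) (g : 𝔻 → AnalyticDisc.UnitBall e)
    (hf : AnalyticDisc.IsEmbeddingMap V f) (hg : AnalyticDisc.IsEmbeddingMap W g)
    (hiso : Nonempty (AnalyticDisc.discAlgebra f ≃ₐ[ℂ] AnalyticDisc.discAlgebra g)) :
    ∃ m : 𝔻 ≃ 𝔻, AnalyticDisc.IsDiscAutomorphism m ∧
      AnalyticDisc.discAlgebra f = AnalyticDisc.discAlgebra (g ∘ m) ∧
      ∃ c C : ℝ, 0 < c ∧ 0 < C ∧ ∀ φ ∈ AnalyticDisc.discAlgebra f,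
        c * AnalyticDisc.discAlgebraNorm f φ ≤ AnalyticDisc.discAlgebraNorm (g ∘ m) φ ∧
        AnalyticDisc.discAlgebraNorm (g ∘ m) φ ≤ C * AnalyticDisc.discAlgebraNorm f φ := by
  obtain ⟨Φ⟩ := hiso
  obtain ⟨m, hm, hΦm⟩ := AnalyticDisc.exists_composition hf hg Φ.toAlgHom Φ.injective
  obtain ⟨n, hn, hΦn⟩ := AnalyticDisc.exists_composition hg hf Φ.symm.toAlgHom Φ.symm.injective
  replace hΦm : ∀ φ z, (Φ φ).1 z = φ.1 (m z) := hΦm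
  replace hΦn : ∀ φ z, (Φ.symm φ).1 z = φ.1 (n z) := hΦn
  have hmn : ∀ z, m (n z) = z := fun z =>
    AnalyticDisc.eq_of_forall_discAlgebra hf.injective fun φ => by
      rw [← hΦm, ← hΦn, Φ.symm_apply_apply]
  have hnm : ∀ z, n (m z) = z := fun z =>
    AnalyticDisc.eq_of_forall_discAlgebra hg.injective fun φ => by
      rw [← hΦn, ← hΦm, Φ.apply_symm_apply]
  let μ : 𝔻 ≃ 𝔻 := ⟨n, m, hmn, hnm⟩
  have hgμ : Function.Injective (g ∘ μ) := hg.injective.comp μ.injective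
  have heq : AnalyticDisc.discAlgebra f = AnalyticDisc.discAlgebra (g ∘ μ) := by
    ext φ
    rw [AnalyticDisc.mem_discAlgebra_iff hgμ]
    constructor
    · intro hφ
      obtain ⟨ψ, hψ, h⟩ := (AnalyticDisc.mem_discAlgebra_iff hg.injective _).1 (Φ ⟨φ, hφ⟩).2
      refine ⟨ψ, hψ, fun z => ?_⟩
      have h1 : (Φ ⟨φ, hφ⟩).1 (n z) = φ (m (n z)) := hΦm _ _
      rw [hmn] at h1
      exact (h (n z)).trans h1
    · rintro ⟨ψ, hψ, h⟩
      have h1 : φ = (Φ.symm (AnalyticDisc.pullback g hg.injective ⟨ψ, hψ⟩)).1 := by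
        funext z
        rw [hΦn]
        exact (h z).symm
      rw [h1]
      exact Subtype.mem _
  obtain ⟨B, hB, hle⟩ := AnalyticDisc.exists_discAlgebraNorm_le hf.injective hgμ heq.le
  obtain ⟨B', hB', hle'⟩ := AnalyticDisc.exists_discAlgebraNorm_le hgμ hf.injective heq.ge
  refine ⟨μ, ⟨hn, hm⟩, heq, B'⁻¹, B, inv_pos.2 hB', hB, fun φ hφ => ⟨?_, hle φ hφ⟩⟩
  rw [inv_mul_le_iff₀ hB']
  exact hle' φ (heq ▸ hφ)
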